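/- Let $\lambda>0$, $\mu_1,\mu_2,\mu_{12}\ge 0$, $0\le p\le 1$ and $q=1-p$. In the $M/M_D/2$ queue, customers arrive according to a Poisson process of rate $\lambda$, independent of the services, at two servers with an infinite waiting room. The services are driven by three kinds of independent exponential clocks (a clock of rate $0$ never rings): clocks $T_1$ and $T_2$ of rates $\mu_1$ and $\mu_2$, which end only the service at server $1$, respectively server $2$, and a common clock $T_{12}$ of rate $\mu_{12}$, which ends the services at both. The (remaining) service time at a busy server $i$ is $X_i=\min(T_i,T_{12})$, where $T_i$ and $T_{12}$ are the remaining times of the clocks, so that, when both servers start together, $(X_1,X_2)$ has the Marshall--Olkin bivariate exponential law $$P(X_1>x,\,X_2>y)=e^{-(\mu_1x+\mu_2y+\mu_{12}\max(x,y))},\qquad x,y\ge 0.$$ A service that starts while the other server continues its service receives a fresh clock $T_i$ and shares the running common clock; if no service continues, a fresh common clock is started. If one server alone completes a service, it takes the next waiting customer, if there is one; if both complete simultaneously, the next two waiting customers (if there are that many) start service, with fresh clocks. A customer who is alone in the system and finds both servers free (an arrival to the empty system, or the only waiting customer at a simultaneous completion) goes to server $1$ with probability $p$ and to server $2$ with probability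 $q$. An arrival that finds one busy server goes to the other one. Let $X(t)$, $t\ge0$, be the state at time $t$, with values in $S=\{0,(1,0),(0,1),2,3,\dots\}$: the state $n=0$ or $n\ge 2$ means $n$ customers in the system, and $(1,0)$, $(0,1)$ mean one customer, in service at server $1$, respectively server $2$. At time $0$ the state has an arbitrary law, is independent of all clocks and routing decisions, and all clocks in use are fresh. Then $\{X(t):t\ge 0\}$ is a continuous-time Markov chain, with right-continuous paths almost surely, whose transition rate matrix $Q=(q_{ij})_{i,j\in S}$ has the entries \begin{align*} &q_{0,0}=-\lambda,\quad q_{0,(1,0)}=p\lambda,\quad q_{0,(0,1)}=q\lambda,\\ &q_{(1,0),0}=\mu_1+\mu_{12},\quad q_{(1,0),(1,0)}=-(\lambda+\mu_1+\mu_{12}),\quad q_{(1,0),2}=\lambda,\\ &q_{(0,1),0}=\mu_2+\mu_{12},\quad q_{(0,1),(0,1)}=-(\lambda+\mu_2+\mu_{12}),\quad q_{(0,1),2}=\lambda,\\ &q_{2,0}=\mu_{12},\quad q_{2,(1,0)}=\mu_2,\quad q_{2,(0,1)}=\mu_1,\\ &q_{3,(1,0)}=p\mu_{12},\quad q_{3,(0,1)}=q\mu_{12},\\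 &q_{i,i-2}=\mu_{12}\ (i\ge 4),\quad q_{i,i-1}=\mu_1+\mu_2\ (i\ge 3),\\ &q_{i,i}=-(\lambda+\mu_1+\mu_2+\mu_{12}),\quad q_{i,i+1}=\lambda\ (i\ge 2), \end{align*} and all other entries equal to $0$. That is, there is a transition function $(P_t)_{t\ge0}$ on $S$ (stochastic matrices with $P_0=I$ and $P_{s+t}=P_sP_t$) with $\lim_{h\downarrow0}(P_h-I)/h=Q$ entrywise, such that for all $t_0\le t_1\le\dots\le t_n$ and $i_0,\dots,i_n\in S$ $$P\big(X(t_0)=i_0,\dots,X(t_n)=i_n\big)=P\big(X(t_0)=i_0\big)\prod_{k=0}^{n-1}P_{t_{k+1}-t_k}(i_k,i_{k+1}).$$ -/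

import Mathlib

open MeasureTheory ProbabilityTheory Filter Topology
open scoped NNReal ENNReal

namespace MMD2

/-! ### The state space `S = {0, (1,0), (0,1), 2, 3, …}` -/

/-- States of the two-server queue. -/
inductive State
  /-- state `0`: nobody in the system -/
  | empty
  /-- state `(1,0)`: one customer, in service at server 1 -/
  | first
  /-- state `(0,1)`: one customer, in service at server 2 -/
  | second
  /-- state `k + 2`: both servers are busy and `k` customers wait in the queue -/
  | both (k : ℕ)
  deriving DecidableEq

instance : MeasurableSpace State := ⊤

/-! ### Sample paths -/

/-- A sequence of clocks whose current clock (index `0`) has run for a further time `t`: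
index `0` holds the remaining time of the current clock, the other indices hold the clocks that
have not been started yet. -/
noncomputable def elapse (t : ℝ≥0∞) (T : ℕ → ℝ≥0∞) : ℕ → ℝ≥0∞
  | 0 => T 0 - t
  | n + 1 => T (n + 1)

/-- Discard the current entry of a sequence; the next one takes its place. -/
def renew {α : Type*} (T : ℕ → α) : ℕ → α := fun n => T (n + 1)

/-- The system just after an event. Entry `0` of each of the four clock sequences is the remaining
time of the running clock, or, for a clock that is not running now (a shock clock of an idle server,
the common clock of an empty system), the clock that will be used when it is started next. -/
structure Config where
  /-- the state of the queue -/
  state : State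
  /-- remaining interarrival time, followed by the later interarrival times -/
  arr : ℕ → ℝ≥0∞
  /-- clocks of the shocks that end the service at server 1 only -/
  one : ℕ → ℝ≥0∞
  /-- clocks of the shocks that end the service at server 2 only -/
  two : ℕ → ℝ≥0∞
  /-- clocks of the common shocks, that end the services at both servers -/
  common : ℕ → ℝ≥0∞
  /-- routing decisions for a customer who finds both servers free; `true` means server 1 -/
  coin : ℕ → Bool

/-- Remaining service time at server 1 when it is busy. -/
noncomputable def Config.serviceOne (c : Config) : ℝ≥0∞ := min (c.one 0) (c.common 0)

/-- Remaining service time at server 2 when it is busy. -/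
noncomputable def Config.serviceTwo (c : Config) : ℝ≥0∞ := min (c.two 0) (c.common 0)

/-- The time until the next arrival or service completion. -/
noncomputable def Config.sojourn (c : Config) : ℝ≥0∞ :=
  match c.state with
  | .empty => c.arr 0
  | .first => min (c.arr 0) c.serviceOne
  | .second => min (c.arr 0) c.serviceTwo
  | .both _ => min (c.arr 0) (min c.serviceOne c.serviceTwo)

/-- The state taken by a customer who is alone in the system and may choose between both servers. -/
def route (b : Bool) : State := if b then .first else .second

/-- The configuration just after the next arrival or service completion. -/
noncomputable def Config.next (c : Config) : Config :=
  match c.state with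
  -- an arrival to the empty system starts fresh clocks (its own one and the common one)
  | .empty =>
      { c with state := route (c.coin 0), arr := renew c.arr, coin := renew c.coin }
  | .first =>
      -- an arrival goes to server 2, with its own fresh clock; the common clock keeps running
      if c.arr 0 < c.serviceOne then
        { c with
          state := .both 0
          arr := renew c.arr
          one := elapse c.sojourn c.one
          common := elapse c.sojourn c.common }
      -- service completion at server 1: its clock and the common one are discarded
      else
        { c with
          state := .empty
          arr := elapse c.sojourn c.arr
          one := renew c.one
          common := renew c.common }
  | .second =>
      if c.arr 0 < c.serviceTwo then
        { c with
          state := .both 0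
          arr := renew c.arr
          two := elapse c.sojourn c.two
          common := elapse c.sojourn c.common }
      else
        { c with
          state := .empty
          arr := elapse c.sojourn c.arr
          two := renew c.two
          common := renew c.common }
  | .both k =>
      -- an arrival joins the queue
      if c.arr 0 < min c.serviceOne c.serviceTwo then
        { c with
          state := .both (k + 1)
          arr := renew c.arr
          one := elapse c.sojourn c.one
          two := elapse c.sojourn c.two
          common := elapse c.sojourn c.common }
      -- server 1 alone completes: it takes the next waiting customer, if any, with a fresh clock
      else if c.serviceOne < c.serviceTwo then
        { c with
          state := match k with
            | 0 => .second
            | j + 1 => .both j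
          arr := elapse c.sojourn c.arr
          one := renew c.one
          two := elapse c.sojourn c.two
          common := elapse c.sojourn c.common }
      -- server 2 alone completes
      else if c.serviceTwo < c.serviceOne then
        { c with
          state := match k with
            | 0 => .first
            | j + 1 => .both j
          arr := elapse c.sojourn c.arr
          one := elapse c.sojourn c.one
          two := renew c.two
          common := elapse c.sojourn c.common }
      -- both complete at the same time; everything restarts with fresh clocks, and a single
      -- waiting customer chooses a server at random
      else
        { c with
          state := match k with
            | 0 => .empty
            | 1 => route (c.coin 0)
            | j + 2 => .both j
          arr := elapse c.sojourn c.arr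
          one := renew c.one
          two := renew c.two
          common := renew c.common
          coin := match k with
            | 1 => renew c.coin
            | _ => c.coin }

/-- The time of the `n`-th event (arrival or service completion); the `0`-th is at time `0`. -/
noncomputable def Config.epoch (c : Config) (n : ℕ) : ℝ≥0∞ :=
  ∑ k ∈ Finset.range n, (Config.next^[k] c).sojourn

open Classical in
/-- The state at time `t`, for the initial configuration `c`: the state just after the `n`-th event
if `t` lies between the `n`-th event (included) and the next one (excluded). The value at times
after infinitely many events is immaterial. -/
noncomputable def Config.stateAt (c : Config) (t : ℝ≥0) : State :=
  if h : ∃ n, (t : ℝ≥0∞) < c.epoch (n + 1) then (Config.next^[Nat.find h] c).state else .empty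

/-! ### The random queue -/

/-- The exponential distribution with rate `r ≥ 0` on `[0, ∞]`; a clock of rate `0` never rings. -/
noncomputable def expLaw (r : ℝ) : Measure ℝ≥0∞ :=
  if 0 < r then (expMeasure r).map ENNReal.ofReal else Measure.dirac ⊤

/-- The four kinds of clocks. -/
inductive Clock
  | arrival
  | one
  | two
  | common

/-- The rate of each kind of clock. -/
def Clock.rate (lam mu1 mu2 mu12 : ℝ) : Clock → ℝ
  | .arrival => lam
  | .one => mu1
  | .two => mu2
  | .common => mu12

/-- The random inputs of the queue: the initial state, the clocks and the routing decisions. -/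
structure Input (Ω : Type*) where
  /-- the initial state -/
  init : Ω → State
  /-- the `n`-th clock of each kind -/
  clock : Clock → ℕ → Ω → ℝ≥0∞
  /-- the `n`-th routing decision -/
  coin : ℕ → Ω → Bool

/-- The initial configuration: the initial state, with all clocks fresh. -/
def Input.config {Ω : Type*} (D : Input Ω) (ω : Ω) : Config where
  state := D.init ω
  arr := fun n => D.clock .arrival n ω
  one := fun n => D.clock .one n ω
  two := fun n => D.clock .two n ω
  common := fun n => D.clock .common n ω
  coin := fun n => D.coin n ω

/-- The queueing process. -/
noncomputable def Input.process {Ω : Type*} (D : Input Ω) (t : ℝ≥0) (ω : Ω) : State :=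
  (D.config ω).stateAt t

/-- The laws of the inputs of the `M/M_D/2` queue: the arrivals are Poisson of rate `lam`
(i.i.d. exponential interarrival times), the shocks have rates `mu1`, `mu2`, `mu12`, a routing
decision is for server 1 with probability `p`; all of these and the initial state, whose law is
arbitrary, are independent. -/
structure Input.IsMMD2 {Ω : Type*} [MeasurableSpace Ω] (D : Input Ω) (P : Measure Ω)
    (lam mu1 mu2 mu12 p : ℝ) : Prop where
  measurable_init : Measurable D.init
  measurable_clock : ∀ c n, Measurable (D.clock c n)
  measurable_coin : ∀ n, Measurable (D.coin n)
  law_clock : ∀ c n, P.map (D.clock c n) = expLaw (c.rate lam mu1 mu2 mu12)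
  law_coin : ∀ n, P {ω | D.coin n ω = true} = ENNReal.ofReal p
  indep_clock : iIndepFun (fun (i : Clock × ℕ) ω => D.clock i.1 i.2 ω) P
  indep_coin : iIndepFun D.coin P
  indep_clock_coin : IndepFun (fun ω (i : Clock × ℕ) => D.clock i.1 i.2 ω)
    (fun ω n => D.coin n ω) P
  indep_init : IndepFun D.init
    (fun ω => ((fun i : Clock × ℕ => D.clock i.1 i.2 ω), (fun n => D.coin n ω))) P

/-! ### The service times are Marshall–Olkin -/

/-- The Marshall–Olkin bivariate exponential distribution, through its survival function. -/
def IsMarshallOlkin {Ω : Type*} [MeasurableSpace Ω] (P : Measure Ω) (X Y : Ω → ℝ≥0∞)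
    (mu1 mu2 mu12 : ℝ) : Prop :=
  ∀ x y : ℝ≥0, P {ω | (x : ℝ≥0∞) < X ω ∧ (y : ℝ≥0∞) < Y ω} =
    ENNReal.ofReal (Real.exp (-(mu1 * x + mu2 * y + mu12 * max (x : ℝ) y)))

theorem expLaw_Ioi {r : ℝ} (hr : 0 ≤ r) (x : ℝ≥0) :
    expLaw r (Set.Ioi (x : ℝ≥0∞)) = ENNReal.ofReal (Real.exp (-(r * x))) := by
  unfold expLaw
  split_ifs with h
  · have := isProbabilityMeasure_expMeasure h
    rw [Measure.map_apply ENNReal.measurable_ofReal measurableSet_Ioi]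
    have hs : ENNReal.ofReal ⁻¹' Set.Ioi (x : ℝ≥0∞) = (Set.Iic (x : ℝ))ᶜ := by
      ext y
      simp [ENNReal.lt_ofReal_iff_toReal_lt]
    have hc := cdf_expMeasure_eq h (x : ℝ)
    rw [if_pos x.coe_nonneg, cdf_eq_real] at hc
    rw [hs, ← ofReal_measureReal, probReal_compl_eq_one_sub measurableSet_Iic, hc]
    congr 1
    ring
  · have : r = 0 := le_antisymm (not_lt.mp h) hr
    subst this
    simp

/-- The service times at two servers that share the common clock are Marshall–Olkin. -/
theorem Input.IsMMD2.isMarshallOlkin {Ω : Type*} [MeasurableSpace Ω] {D : Input Ω} {P : Measure Ω}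
    {lam mu1 mu2 mu12 p : ℝ} (h1 : 0 ≤ mu1) (h2 : 0 ≤ mu2) (h12 : 0 ≤ mu12)
    (h : D.IsMMD2 P lam mu1 mu2 mu12 p) (k l m : ℕ) :
    IsMarshallOlkin P (fun ω => min (D.clock .one k ω) (D.clock .common m ω))
      (fun ω => min (D.clock .two l ω) (D.clock .common m ω)) mu1 mu2 mu12 := by
  intro x y
  let g : Fin 3 → Clock × ℕ := ![(.one, k), (.two, l), (.common, m)]
  have hg : Function.Injective g := by
    intro a b hab
    fin_cases a <;> fin_cases b <;> simp [g] at hab ⊢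
  have hi := (h.indep_clock.precomp hg).measure_inter_preimage_eq_mul (S := Finset.univ)
    (sets := ![Set.Ioi (x : ℝ≥0∞), Set.Ioi (y : ℝ≥0∞), Set.Ioi (max x y : ℝ≥0∞)])
    (by intro i _; fin_cases i <;> exact measurableSet_Ioi)
  have hset : {ω | (x : ℝ≥0∞) < min (D.clock .one k ω) (D.clock .common m ω) ∧
      (y : ℝ≥0∞) < min (D.clock .two l ω) (D.clock .common m ω)} =
      ⋂ i ∈ (Finset.univ : Finset (Fin 3)), (fun ω => D.clock (g i).1 (g i).2 ω) ⁻¹'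
        (![Set.Ioi (x : ℝ≥0∞), Set.Ioi (y : ℝ≥0∞), Set.Ioi (max x y : ℝ≥0∞)] i) := by
    ext ω
    simp [Fin.forall_fin_succ, g]
    tauto
  have key : ∀ (c : Clock) (n : ℕ) (z : ℝ≥0), 0 ≤ c.rate lam mu1 mu2 mu12 →
      P (D.clock c n ⁻¹' Set.Ioi (z : ℝ≥0∞)) =
        ENNReal.ofReal (Real.exp (-(c.rate lam mu1 mu2 mu12 * z))) := by
    intro c n z hc
    rw [← Measure.map_apply (h.measurable_clock c n) measurableSet_Ioi, h.law_clock,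
      expLaw_Ioi hc]
  have e1 := key .one k x h1
  have e2 := key .two l y h2
  have e3 := key .common m (max x y) h12
  rw [hset]
  refine hi.trans ?_
  rw [Fin.prod_univ_three]
  simp only [ENNReal.coe_max] at e3
  refine (congrArg₂ (· * ·) (congrArg₂ (· * ·) e1 e2) e3).trans ?_
  rw [← ENNReal.ofReal_mul (by positivity), ← ENNReal.ofReal_mul (by positivity), ← Real.exp_add,
    ← Real.exp_add]
  simp only [Clock.rate, NNReal.coe_max]
  congr 2
  ring

/-! ### Continuous-time Markov chains -/

/-- `p t i j` is the transition function of a (conservative) continuous-time Markov chain. -/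
structure IsTransitionFunction {S : Type*} [DecidableEq S] (p : ℝ≥0 → S → S → ℝ) : Prop where
  nonneg : ∀ t i j, 0 ≤ p t i j
  hasSum_one : ∀ t i, HasSum (p t i) 1
  zero : ∀ i j, p 0 i j = if i = j then 1 else 0
  /-- the Chapman–Kolmogorov equations -/
  add : ∀ s t i j, HasSum (fun k => p s i k * p t k j) (p (s + t) i j)

/-- `Q` is the transition rate matrix of the transition function `p`: `Q = p'(0+)`. -/
def HasRateMatrix {S : Type*} [DecidableEq S] (p : ℝ≥0 → S → S → ℝ) (Q : S → S → ℝ) : Prop :=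
  ∀ i j, Tendsto (fun h : ℝ≥0 => (p h i j - if i = j then 1 else 0) / (h : ℝ)) (𝓝[>] 0)
    (𝓝 (Q i j))

/-- `X` is a (time-homogeneous, right-continuous) continuous-time Markov chain with transition rate
matrix `Q`. -/
structure IsCTMC {Ω S : Type*} [MeasurableSpace Ω] [MeasurableSpace S] [DecidableEq S]
    (P : Measure Ω) (X : ℝ≥0 → Ω → S) (Q : S → S → ℝ) : Prop where
  measurable : ∀ t, Measurable (X t)
  /-- right-continuity of the paths, for the discrete topology -/
  right_continuous : ∀ᵐ ω ∂P, ∀ t, ∀ᶠ s in 𝓝[≥] t, X s ω = X t ω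
  /-- the Markov property, with transition probabilities whose rates are given by `Q` -/
  markov : ∃ p : ℝ≥0 → S → S → ℝ, IsTransitionFunction p ∧ HasRateMatrix p Q ∧
    ∀ (n : ℕ) (t : ℕ → ℝ≥0) (i : ℕ → S), Monotone t →
      P.real {ω | ∀ k ≤ n, X (t k) ω = i k} =
        P.real {ω | X (t 0) ω = i 0} *
          ∏ k ∈ Finset.range n, p (t (k + 1) - t k) (i k) (i (k + 1))

/-! ### The transition rate matrix -/

/-- The matrix `Q`; recall that `State.both k` is state `k + 2`. -/
def rateMatrix (lam mu1 mu2 mu12 p : ℝ) : State → State → ℝ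
  | .empty, .empty => -lam
  | .empty, .first => p * lam
  | .empty, .second => (1 - p) * lam
  | .first, .empty => mu1 + mu12
  | .first, .first => -(lam + mu1 + mu12)
  | .first, .both 0 => lam
  | .second, .empty => mu2 + mu12
  | .second, .second => -(lam + mu2 + mu12)
  | .second, .both 0 => lam
  | .both 0, .empty => mu12
  | .both 0, .first => mu2
  | .both 0, .second => mu1
  | .both 1, .first => p * mu12
  | .both 1, .second => (1 - p) * mu12
  | .both k, .both l =>
      if l = k then -(lam + mu1 + mu2 + mu12)
      else if l = k + 1 then lam
      else if l + 1 = k then mu1 + mu2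
      else if l + 2 = k then mu12
      else 0
  | _, _ => 0

end MMD2

namespace MMD2

/-! An exponential clock that has survived until time `s` has a remaining time with the original
law, and a discarded clock is replaced by an independent fresh one. Hence, at an event or at a fixed
time before the first event, all clocks are again fresh given the state, and the state alone governs
the future.

The first event is a race between the clocks in `active i`. If `w` wins at time `x`, its density `ρ
w * exp (-ρ w * x)` is multiplied by the probability that the other running clocks survive `x`. This
gives `ρ w * exp (-r * x)`, with `r` the total rate, times the law of fresh clocks
(`lintegral_firstRing`). Combined with the pathwise description of an event (`next_of_firstRing`),
it yields `lintegral_sojourn_next`: from state `i` the first event comes at rate `totalRate ρ i`,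
the next state is distributed as the normalized measure `jump ρ β i`, independently of the time, and
the inputs are fresh.

For the Markov property at a fixed time `t`, split according to the number `n` of events up to `t`
and use induction on `n` (`inputsLaw_events_visit`): `n = 0` is memorylessness (`inputsLaw_shift`),
and the step conditions on the first event. All total rates are at most `R = ∑ c, ρ c`, so the
probability of `n` events up to `t` is at most `(1 - exp (-R * t)) ^ n`. Thus events do not
accumulate (`ae_regular`), which gives right-continuity and allows summation over `n`
(`inputsLaw_markov`). Chapman–Kolmogorov and the product formula for paths follow.

For the rates, two events up to time `h` have probability at most `(R * h) ^ 2`, so only the paths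
with no event or one event matter to first order (`abs_transition_sub_le`). The derivative at `0` is
read off from `jump`, and `rateMatrix_eq` compares it with the matrix. An arbitrary initial law is
handled by averaging over the independent initial state. -/

/-! ### Sequences of i.i.d. random variables -/

/-- Put a new entry in front of a sequence. -/
def prepend {X : Type*} (x : X) (T : ℕ → X) : ℕ → X
  | 0 => x
  | n + 1 => T n

@[simp] theorem prepend_zero {X : Type*} (x : X) (T : ℕ → X) : prepend x T 0 = x := rfl

@[simp] theorem renew_prepend {X : Type*} (x : X) (T : ℕ → X) : renew (prepend x T) = T := rfl

section Iid

variable {X : Type*} [MeasurableSpace X]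

/-- The law of an i.i.d. sequence with common law `μ`. -/
noncomputable def iid (μ : Measure X) [IsProbabilityMeasure μ] : Measure (ℕ → X) :=
  Measure.infinitePi fun _ => μ

instance (μ : Measure X) [IsProbabilityMeasure μ] : IsProbabilityMeasure (iid μ) := by
  unfold iid; infer_instance

@[fun_prop]
theorem measurable_prepend : Measurable fun q : X × (ℕ → X) => prepend q.1 q.2 := by
  refine measurable_pi_lambda _ fun n => ?_
  cases n <;> simp only [prepend] <;> fun_prop

@[fun_prop]
theorem measurable_renew : Measurable (renew : (ℕ → X) → ℕ → X) := by
  unfold renew; fun_prop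

/-- Cylinders determine the product measure, and a cylinder for the prepended sequence splits into a
condition on the head and a cylinder for the tail, with indices lowered by one. -/
theorem map_prepend_iid (μ : Measure X) [IsProbabilityMeasure μ] :
    (μ.prod (iid μ)).map (fun q => prepend q.1 q.2) = iid μ := by
  refine Measure.eq_infinitePi _ fun s t ht => ?_
  classical
  have hinj : Set.InjOn Nat.succ (Nat.succ ⁻¹' (s : Set ℕ)) := Nat.succ_injective.injOn
  have hpre : (fun q : X × (ℕ → X) => prepend q.1 q.2) ⁻¹' (Set.pi s t) =
      (if 0 ∈ s then t 0 else Set.univ) ×ˢ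
        (Set.pi (s.preimage Nat.succ hinj) fun n => t (n + 1)) := by
    ext ⟨x, T⟩
    simp only [Set.mem_preimage, Set.mem_pi, Finset.mem_coe, Set.mem_prod, Finset.mem_preimage]
    constructor
    · intro h
      refine ⟨?_, fun i hi => h _ hi⟩
      split_ifs with h0
      · exact h 0 h0
      · trivial
    · rintro ⟨h0, h1⟩ i hi
      cases i with
      | zero => simpa [hi] using h0
      | succ n => exact h1 n hi
  rw [Measure.map_apply measurable_prepend (.pi s.countable_toSet fun i _ => ht i), hpre,
    Measure.prod_prod, iid, Measure.infinitePi_pi _ fun i _ => ht (i + 1),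
    Finset.prod_preimage' Nat.succ s hinj fun n => μ (t n),
    ← Finset.prod_filter_not_mul_prod_filter s (· ∈ Set.range Nat.succ)]
  congr 1
  have : {x ∈ s | x ∉ Set.range Nat.succ} = if 0 ∈ s then {0} else ∅ := by
    ext n
    cases n <;> split_ifs <;> simp [*]
  rw [this]
  split_ifs <;> simp

theorem lintegral_iid (μ : Measure X) [IsProbabilityMeasure μ] {f : (ℕ → X) → ℝ≥0∞}
    (hf : Measurable f) :
    ∫⁻ T, f T ∂iid μ = ∫⁻ x, ∫⁻ T, f (prepend x T) ∂iid μ ∂μ := by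
  rw [← lintegral_prod (fun q : X × (ℕ → X) => f (prepend q.1 q.2)) (by fun_prop)]
  nth_rw 1 [← map_prepend_iid μ]
  rw [lintegral_map hf measurable_prepend]

end Iid

/-! ### Exponential clocks -/

/-- The survival function of the exponential law of rate `r`, at finite times. -/
noncomputable def survival (r : ℝ) (x : ℝ≥0∞) : ℝ≥0∞ :=
  ENNReal.ofReal (Real.exp (-(r * x.toReal)))

@[fun_prop]
theorem measurable_survival (r : ℝ) : Measurable (survival r) := by
  unfold survival; fun_prop

theorem survival_ne_top (r : ℝ) (x : ℝ≥0∞) : survival r x ≠ ⊤ := ENNReal.ofReal_ne_top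

theorem survival_zero_left (x : ℝ≥0∞) : survival 0 x = 1 := by simp [survival]

theorem survival_add_left (r s : ℝ) (x : ℝ≥0∞) :
    survival (r + s) x = survival r x * survival s x := by
  rw [survival, survival, survival, ← ENNReal.ofReal_mul (by positivity), ← Real.exp_add]
  congr 2
  ring

theorem survival_add (r : ℝ) {x y : ℝ≥0∞} (hx : x ≠ ⊤) (hy : y ≠ ⊤) :
    survival r (x + y) = survival r x * survival r y := by
  rw [survival, survival, survival, ← ENNReal.ofReal_mul (by positivity), ← Real.exp_add,
    ENNReal.toReal_add hx hy]
  congr 2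
  ring

theorem survival_sum {ι : Type*} (s : Finset ι) (r : ι → ℝ) (x : ℝ≥0∞) :
    survival (∑ i ∈ s, r i) x = ∏ i ∈ s, survival (r i) x := by
  classical
  induction s using Finset.induction_on with
  | empty => simp [survival_zero_left]
  | insert a s ha ih => rw [Finset.sum_insert ha, Finset.prod_insert ha, survival_add_left, ih]

instance (r : ℝ) : IsProbabilityMeasure (expLaw r) := by
  unfold expLaw
  split_ifs with h
  · have := isProbabilityMeasure_expMeasure h
    exact Measure.isProbabilityMeasure_map (by fun_prop)
  · infer_instance

theorem expLaw_Ioi_eq_survival {r : ℝ} (hr : 0 ≤ r) {x : ℝ≥0∞} (hx : x ≠ ⊤) :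
    expLaw r (Set.Ioi x) = survival r x := by
  lift x to ℝ≥0 using hx
  exact expLaw_Ioi hr x

/-- Memorylessness of a single clock. For the tails it is the functional equation of the
exponential, and total mass and tails determine a finite measure on `[0, ∞]`. -/
theorem map_sub_expLaw {r : ℝ} (hr : 0 ≤ r) {s : ℝ≥0∞} (hs : s ≠ ⊤) :
    ((expLaw r).restrict (Set.Ioi s)).map (fun x => x - s) = survival r s • expLaw r := by
  have hfin : IsFiniteMeasure (((expLaw r).restrict (Set.Ioi s)).map fun x => x - s) :=
    Measure.isFiniteMeasure_map _ _
  have huniv : ((expLaw r).restrict (Set.Ioi s)).map (fun x => x - s) Set.univ =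
      (survival r s • expLaw r) Set.univ := by
    rw [Measure.map_apply (by fun_prop) .univ]
    simp [expLaw_Ioi_eq_survival hr hs]
  have hfin' : IsFiniteMeasure (survival r s • expLaw r) := by
    constructor; rw [← huniv]; exact measure_lt_top _ _
  refine Measure.ext_of_Iic _ _ fun a => ?_
  have hc : ∀ ν : Measure ℝ≥0∞, IsFiniteMeasure ν → ν (Set.Iic a) = ν Set.univ - ν (Set.Ioi a) := by
    intro ν _
    rw [← Set.compl_Ioi, measure_compl measurableSet_Ioi (measure_ne_top _ _)]
  rw [hc _ hfin, hc _ hfin', huniv]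
  congr 1
  rw [Measure.map_apply (by fun_prop) measurableSet_Ioi]
  -- The tail beyond `⊤` is empty, whereas `survival r ⊤` is `1` because `⊤.toReal = 0`; so this
  -- case is separate.
  by_cases ha : a = ⊤
  · simp [ha]
  rw [Measure.restrict_apply (measurableSet_Ioi.preimage (by fun_prop)), Measure.smul_apply,
    expLaw_Ioi_eq_survival hr ha, smul_eq_mul, ← survival_add r hs ha,
    ← expLaw_Ioi_eq_survival hr (by finiteness)]
  congr 1
  ext x
  simp only [Set.mem_inter_iff, Set.mem_preimage, Set.mem_Ioi, lt_tsub_iff_left]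
  exact ⟨fun h => h.1, fun h => ⟨h, lt_of_le_of_lt le_self_add h⟩⟩

theorem lintegral_sub_expLaw {r : ℝ} (hr : 0 ≤ r) {s : ℝ≥0∞} (hs : s ≠ ⊤) {f : ℝ≥0∞ → ℝ≥0∞}
    (hf : Measurable f) :
    ∫⁻ x in Set.Ioi s, f (x - s) ∂expLaw r = survival r s * ∫⁻ x, f x ∂expLaw r := by
  rw [← lintegral_map (f := f) (g := fun x => x - s) hf (by fun_prop), map_sub_expLaw hr hs,
    lintegral_smul_measure, smul_eq_mul]

/-- Lebesgue measure on `(0, ∞)`, as a measure on `[0, ∞]`. -/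
noncomputable def lebesgue : Measure ℝ≥0∞ :=
  (volume.restrict (Set.Ioi (0 : ℝ))).map ENNReal.ofReal

instance : SFinite lebesgue := by unfold lebesgue; infer_instance

theorem ae_ne_top_lebesgue : ∀ᵐ x ∂lebesgue, x ≠ ⊤ := by
  rw [lebesgue, ae_map_iff (by fun_prop) (p := fun x => x ≠ ⊤) (measurableSet_singleton _).compl]
  simp

theorem expLaw_eq_withDensity {r : ℝ} (hr : 0 < r) :
    expLaw r = ENNReal.ofReal r • lebesgue.withDensity (survival r) := by
  have h1 : expMeasure r = (volume.restrict (Set.Ioi (0 : ℝ))).withDensity (exponentialPDF r) := by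
    rw [← restrict_withDensity measurableSet_Ioi]
    have : expMeasure r = volume.withDensity (exponentialPDF r) := rfl
    rw [← this, eq_comm, Measure.restrict_eq_self_of_ae_mem]
    have h0 : ∀ᵐ x ∂expMeasure r, ¬ x ≤ 0 := by
      have := isProbabilityMeasure_expMeasure hr
      have hc := cdf_expMeasure_eq hr 0
      rw [cdf_eq_real] at hc
      simp only [le_refl, if_true, mul_zero, neg_zero, Real.exp_zero, sub_self] at hc
      rw [measureReal_eq_zero_iff] at hc
      exact measure_eq_zero_iff_ae_notMem.1 hc
    filter_upwards [h0] with x hx using not_le.1 hx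
  ext s hs
  rw [expLaw, if_pos hr, Measure.map_apply (by fun_prop) hs, h1,
    withDensity_apply _ (hs.preimage (by fun_prop)), Measure.smul_apply, withDensity_apply _ hs,
    lebesgue, Measure.restrict_map (by fun_prop) hs, lintegral_map (by fun_prop) (by fun_prop),
    smul_eq_mul, ← lintegral_const_mul _ (by fun_prop)]
  refine lintegral_congr_ae ?_
  have : ∀ᵐ x ∂(volume.restrict (Set.Ioi (0 : ℝ))), 0 < x := ae_restrict_mem measurableSet_Ioi
  filter_upwards [ae_restrict_of_ae this] with x hx
  rw [exponentialPDF_of_nonneg hx.le, survival, ENNReal.toReal_ofReal hx.le,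
    ENNReal.ofReal_mul hr.le]

/-- At rate `0` the law is the point mass at `⊤`, which has no density; the formula persists when `f
⊤ = 0`, both sides being zero. -/
theorem lintegral_expLaw {r : ℝ} (hr : 0 ≤ r) {f : ℝ≥0∞ → ℝ≥0∞} (hf : Measurable f)
    (h : 0 < r ∨ f ⊤ = 0) :
    ∫⁻ x, f x ∂expLaw r = ENNReal.ofReal r * ∫⁻ x, survival r x * f x ∂lebesgue := by
  rcases hr.eq_or_lt with rfl | hr
  · have : f ⊤ = 0 := by simpa using h
    simp [expLaw, this, lintegral_dirac]
  · rw [expLaw_eq_withDensity hr, lintegral_smul_measure,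
      lintegral_withDensity_eq_lintegral_mul _ (by fun_prop) hf]
    rfl

/-! ### Sequences of exponential clocks -/

@[fun_prop]
theorem measurable_elapse : Measurable fun q : ℝ≥0∞ × (ℕ → ℝ≥0∞) => elapse q.1 q.2 := by
  refine measurable_pi_lambda _ fun n => ?_
  cases n <;> simp only [elapse] <;> fun_prop

theorem measurable_elapse_right (s : ℝ≥0∞) : Measurable (elapse s) :=
  measurable_elapse.comp (measurable_const.prodMk measurable_id)

theorem elapse_prepend (s x : ℝ≥0∞) (T : ℕ → ℝ≥0∞) :
    elapse s (prepend x T) = prepend (x - s) T := by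
  funext n; cases n <;> rfl

theorem measurableSet_lt_head (s : ℝ≥0∞) : MeasurableSet {T : ℕ → ℝ≥0∞ | s < T 0} :=
  measurableSet_lt (by fun_prop) (by fun_prop)

theorem map_elapse_iid {r : ℝ} (hr : 0 ≤ r) {s : ℝ≥0∞} (hs : s ≠ ⊤) :
    ((iid (expLaw r)).restrict {T | s < T 0}).map (elapse s) = survival r s • iid (expLaw r) := by
  refine Measure.ext_of_lintegral _ fun f hf => ?_
  have he := measurable_elapse_right s
  rw [lintegral_map hf he, lintegral_smul_measure, smul_eq_mul,
    ← lintegral_indicator (measurableSet_lt_head s), lintegral_iid _ hf, lintegral_iid _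
      (Measurable.indicator (by fun_prop) (measurableSet_lt_head s)),
    ← lintegral_sub_expLaw hr hs (f := fun x => ∫⁻ T, f (prepend x T) ∂iid (expLaw r))
      (Measurable.lintegral_prod_right' (f := fun q : ℝ≥0∞ × (ℕ → ℝ≥0∞) => f (prepend q.1 q.2))
        (by fun_prop)),
    ← lintegral_indicator measurableSet_Ioi]
  refine lintegral_congr fun x => ?_
  by_cases hx : s < x <;> simp [Set.indicator, hx, elapse_prepend]

/-- The tail of the sequence is independent of the head, so only the survival probability of the
head remains. The factor is the same as in `map_elapse_iid`: whether a surviving clock is kept or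
discarded makes no difference to the law. -/
theorem map_renew_iid {r : ℝ} (hr : 0 ≤ r) {s : ℝ≥0∞} (hs : s ≠ ⊤) :
    ((iid (expLaw r)).restrict {T | s < T 0}).map renew = survival r s • iid (expLaw r) := by
  refine Measure.ext_of_lintegral _ fun f hf => ?_
  rw [lintegral_map hf measurable_renew, lintegral_smul_measure, smul_eq_mul,
    ← lintegral_indicator (measurableSet_lt_head s), lintegral_iid _
      (Measurable.indicator (by fun_prop) (measurableSet_lt_head s)),
    ← expLaw_Ioi_eq_survival hr hs, mul_comm, ← lintegral_indicator_const measurableSet_Ioi]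
  refine lintegral_congr fun x => ?_
  by_cases hx : s < x <;> simp [Set.indicator, hx]

/-! ### Finite products -/

section Pi

variable {ι : Type*} [Fintype ι] {X : ι → Type*} [∀ i, MeasurableSpace (X i)]
  (μ : ∀ i, Measure (X i)) [∀ i, IsProbabilityMeasure (μ i)]

/-- Reduces memorylessness of the whole family to one clock at a time: restriction to a box and
coordinatewise maps preserve product measures. -/
theorem pi_restrict_map {U : ∀ i, Set (X i)} {φ : ∀ i, X i → X i} {k : ι → ℝ≥0∞}
    (hφ : ∀ i, Measurable (φ i))
    (h : ∀ i, ((μ i).restrict (U i)).map (φ i) = k i • μ i) :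
    ((Measure.pi μ).restrict (Set.univ.pi U)).map (fun T i => φ i (T i)) =
      (∏ i, k i) • Measure.pi μ := by
  rw [Measure.restrict_pi_pi, Measure.pi_map_pi fun i => (hφ i).aemeasurable]
  refine Measure.pi_eq fun s hs => ?_
  simp only [h, Measure.smul_apply, Measure.pi_pi, smul_eq_mul, Finset.prod_mul_distrib]

end Pi

/-- In a family of i.i.d. sequences, the head of one sequence is independent of the rest. -/
theorem map_update_prepend_pi {ι : Type*} [Fintype ι] [DecidableEq ι] {X : Type*}
    [MeasurableSpace X] (μ : ι → Measure X) [∀ i, IsProbabilityMeasure (μ i)] (w : ι) :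
    ((μ w).prod (Measure.pi fun i => iid (μ i))).map
        (fun q => Function.update q.2 w (prepend q.1 (q.2 w))) =
      Measure.pi fun i => iid (μ i) := by
  have hm : Measurable fun q : X × (ι → ℕ → X) =>
      Function.update q.2 w (prepend q.1 (q.2 w)) := by
    refine measurable_pi_lambda _ fun i => ?_
    by_cases hi : i = w
    · subst hi; simp only [Function.update_self]; fun_prop
    · simp only [Function.update_of_ne hi]; fun_prop
  refine (Measure.pi_eq fun s hs => ?_).symm
  rw [Measure.map_apply hm (.univ_pi hs),
    Measure.prod_apply ((MeasurableSet.univ_pi hs).preimage hm)]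
  have key : ∀ x, (Measure.pi fun i => iid (μ i)) (Prod.mk x ⁻¹'
      ((fun q : X × (ι → ℕ → X) => Function.update q.2 w (prepend q.1 (q.2 w))) ⁻¹'
        Set.univ.pi s)) =
      iid (μ w) (prepend x ⁻¹' s w) * ∏ i ∈ Finset.univ.erase w, iid (μ i) (s i) := by
    intro x
    have : Prod.mk x ⁻¹' ((fun q : X × (ι → ℕ → X) =>
        Function.update q.2 w (prepend q.1 (q.2 w))) ⁻¹' Set.univ.pi s) =
        Set.univ.pi (Function.update s w (prepend x ⁻¹' s w)) := by
      ext T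
      simp only [Set.mem_preimage, Set.mem_univ_pi]
      refine forall_congr' fun i => ?_
      by_cases hi : i = w
      · subst hi; simp
      · simp [Function.update_of_ne hi]
    rw [this, Measure.pi_pi, ← Finset.mul_prod_erase _ _ (Finset.mem_univ w), Function.update_self]
    congr 1
    exact Finset.prod_congr rfl fun i hi => by
      rw [Function.update_of_ne (Finset.ne_of_mem_erase hi)]
  simp only [key]
  rw [lintegral_mul_const', ← Finset.mul_prod_erase _ _ (Finset.mem_univ w)]
  · congr 1
    nth_rw 2 [← map_prepend_iid (μ w)]
    rw [Measure.map_apply measurable_prepend (hs w),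
      Measure.prod_apply ((hs w).preimage measurable_prepend)]
    rfl
  · exact ENNReal.prod_ne_top fun i _ => measure_ne_top _ _

theorem lintegral_pi_update_prepend {ι : Type*} [Fintype ι] [DecidableEq ι] {X : Type*}
    [MeasurableSpace X] (μ : ι → Measure X) [∀ i, IsProbabilityMeasure (μ i)] (w : ι)
    {f : (ι → ℕ → X) → ℝ≥0∞} (hf : Measurable f) :
    ∫⁻ T, f T ∂(Measure.pi fun i => iid (μ i)) =
      ∫⁻ x, ∫⁻ T, f (Function.update T w (prepend x (T w))) ∂(Measure.pi fun i => iid (μ i))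
        ∂(μ w) := by
  have hm : Measurable fun q : X × (ι → ℕ → X) =>
      Function.update q.2 w (prepend q.1 (q.2 w)) := by
    refine measurable_pi_lambda _ fun i => ?_
    by_cases hi : i = w
    · subst hi; simp only [Function.update_self]; fun_prop
    · simp only [Function.update_of_ne hi]; fun_prop
  rw [← lintegral_prod (fun q : X × (ι → ℕ → X) =>
    f (Function.update q.2 w (prepend q.1 (q.2 w)))) (hf.comp hm).aemeasurable]
  nth_rw 1 [← map_update_prepend_pi μ w]
  rw [lintegral_map hf hm]

/-! ### The race of exponential clocks -/

section Race

variable {ι : Type*} [DecidableEq ι]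

/-- The effect of an event, at time `s`, on the clocks in the finite set `A` of running clocks: the
clocks in `D` are discarded, the other ones keep running. -/
noncomputable def advance (A D : Finset ι) (s : ℝ≥0∞) (T : ι → ℕ → ℝ≥0∞) (i : ι) : ℕ → ℝ≥0∞ :=
  if i ∈ D then renew (T i) else if i ∈ A then elapse s (T i) else T i

/-- The clock `w` is the first one in `A` to ring. -/
def firstRing (A : Finset ι) (w : ι) : Set (ι → ℕ → ℝ≥0∞) := {T | ∀ i ∈ A.erase w, T w 0 < T i 0}

theorem measurableSet_firstRing (A : Finset ι) (w : ι) : MeasurableSet (firstRing A w) := by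
  have : firstRing A w = ⋂ i ∈ A.erase w, {T : ι → ℕ → ℝ≥0∞ | T w 0 < T i 0} := by
    ext T; simp [firstRing]
  rw [this]
  exact Finset.measurableSet_biInter _ fun i _ => measurableSet_lt (by fun_prop) (by fun_prop)

@[fun_prop]
theorem measurable_advance (A D : Finset ι) :
    Measurable fun q : ℝ≥0∞ × (ι → ℕ → ℝ≥0∞) => advance A D q.1 q.2 := by
  refine measurable_pi_lambda _ fun i => ?_
  unfold advance
  split_ifs
  · exact measurable_renew.comp (by fun_prop)
  · exact measurable_elapse.comp (f := fun q : ℝ≥0∞ × (ι → ℕ → ℝ≥0∞) => (q.1, q.2 i)) (by fun_prop)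
  · fun_prop

/-- The joint law of independent sequences of exponential clocks with rates `ρ`. -/
noncomputable def clocksLaw [Fintype ι] (ρ : ι → ℝ) : Measure (ι → ℕ → ℝ≥0∞) :=
  Measure.pi fun i => iid (expLaw (ρ i))

variable [Fintype ι] {ρ : ι → ℝ}

instance : IsProbabilityMeasure (clocksLaw ρ) := by unfold clocksLaw; infer_instance

/-- Memorylessness: given that the clocks in `A` survive `s`, all clocks are fresh at time `s`. -/
theorem map_advance_clocksLaw (hρ : ∀ i, 0 ≤ ρ i) (A D : Finset ι) (hD : D ⊆ A) {s : ℝ≥0∞}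
    (hs : s ≠ ⊤) :
    ((clocksLaw ρ).restrict {T | ∀ i ∈ A, s < T i 0}).map (advance A D s) =
      survival (∑ i ∈ A, ρ i) s • clocksLaw ρ := by
  have hset : {T : ι → ℕ → ℝ≥0∞ | ∀ i ∈ A, s < T i 0} =
      Set.univ.pi fun i => if i ∈ A then {T | s < T 0} else Set.univ := by
    ext T
    simp only [Set.mem_ofPred_eq, Set.mem_univ_pi]
    refine forall_congr' fun i => ?_
    by_cases hi : i ∈ A <;> simp [hi]
  have := pi_restrict_map (fun i => iid (expLaw (ρ i)))
    (U := fun i => if i ∈ A then {T | s < T 0} else Set.univ)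
    (φ := fun i T => if i ∈ D then renew T else if i ∈ A then elapse s T else T)
    (k := fun i => if i ∈ A then survival (ρ i) s else 1) (fun i => ?_) fun i => ?_
  · rw [Finset.prod_ite_mem, Finset.univ_inter] at this
    rw [hset, survival_sum]
    exact this
  · split_ifs
    exacts [measurable_renew, measurable_elapse_right s, measurable_id]
  · by_cases hi : i ∈ D
    · simp only [hi, hD hi, if_true]
      exact map_renew_iid (hρ i) hs
    · by_cases hA : i ∈ A
      · simp only [hi, hA, if_true, if_false]
        exact map_elapse_iid (hρ i) hs
      · simp [hi, hA]

/-- The law of the clocks just after the first one in `A` has rung, on the event that this is `w`: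
the time is exponential and the clocks are fresh. -/
theorem lintegral_firstRing (hρ : ∀ i, 0 ≤ ρ i) {A D : Finset ι} (hD : D ⊆ A) {w : ι} (hw : w ∈ D)
    (hpos : 0 < ρ w ∨ (A.erase w).Nonempty) {f : ℝ≥0∞ → (ι → ℕ → ℝ≥0∞) → ℝ≥0∞}
    (hf : Measurable (Function.uncurry f)) :
    ∫⁻ T in firstRing A w, f (T w 0) (advance A D (T w 0) T) ∂clocksLaw ρ =
      ENNReal.ofReal (ρ w) *
        ∫⁻ x, survival (∑ i ∈ A, ρ i) x * ∫⁻ T, f x T ∂clocksLaw ρ ∂lebesgue := by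
  have hE : ∀ x, MeasurableSet {T : ι → ℕ → ℝ≥0∞ | ∀ i ∈ A.erase w, x < T i 0} := fun x => by
    have : {T : ι → ℕ → ℝ≥0∞ | ∀ i ∈ A.erase w, x < T i 0} =
        ⋂ i ∈ A.erase w, {T : ι → ℕ → ℝ≥0∞ | x < T i 0} := by ext; simp
    rw [this]
    exact Finset.measurableSet_biInter _ fun i _ => measurableSet_lt (by fun_prop) (by fun_prop)
  have hE2 : MeasurableSet {q : ℝ≥0∞ × (ι → ℕ → ℝ≥0∞) | ∀ i ∈ A.erase w, q.1 < q.2 i 0} := by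
    have : {q : ℝ≥0∞ × (ι → ℕ → ℝ≥0∞) | ∀ i ∈ A.erase w, q.1 < q.2 i 0} =
        ⋂ i ∈ A.erase w, {q : ℝ≥0∞ × (ι → ℕ → ℝ≥0∞) | q.1 < q.2 i 0} := by ext; simp
    rw [this]
    exact Finset.measurableSet_biInter _ fun i _ => measurableSet_lt (by fun_prop) (by fun_prop)
  have hg : Measurable fun T : ι → ℕ → ℝ≥0∞ => f (T w 0) (advance A D (T w 0) T) :=
    hf.comp (Measurable.prodMk (by fun_prop) ((measurable_advance A D).comp
      (Measurable.prodMk (by fun_prop) measurable_id)))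
  -- As `w ∈ D`, renewal removes the entry `x` just prepended. So `w` drops out of both sets, and
  -- the other clocks only have to survive the constant time `x`.
  have hadv : ∀ x (T : ι → ℕ → ℝ≥0∞), advance A D x (Function.update T w (prepend x (T w))) =
      advance (A.erase w) (D.erase w) x T := by
    intro x T
    funext i
    by_cases hi : i = w
    · subst hi; simp [advance, hw]
    · simp [advance, hi]
  have hfr : ∀ x (T : ι → ℕ → ℝ≥0∞), Function.update T w (prepend x (T w)) ∈ firstRing A w ↔
      ∀ i ∈ A.erase w, x < T i 0 := by
    intro x T
    refine forall₂_congr fun i hi => ?_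
    rw [Function.update_self, Function.update_of_ne (Finset.ne_of_mem_erase hi), prepend_zero]
  have hfx : ∀ x, Measurable (f x) := fun x => hf.comp (measurable_const.prodMk measurable_id)
  set G : ℝ≥0∞ → ℝ≥0∞ := fun x => ∫⁻ T in {T | ∀ i ∈ A.erase w, x < T i 0},
    f x (advance (A.erase w) (D.erase w) x T) ∂clocksLaw ρ with hG
  have hGm : Measurable G := by
    have : G = fun x => ∫⁻ T,
        ({q : ℝ≥0∞ × (ι → ℕ → ℝ≥0∞) | ∀ i ∈ A.erase w, q.1 < q.2 i 0}.indicator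
        fun q => f q.1 (advance (A.erase w) (D.erase w) q.1 q.2)) (x, T) ∂clocksLaw ρ := by
      funext x
      rw [hG]
      simp only
      rw [← lintegral_indicator (hE x)]
      rfl
    rw [this]
    refine Measurable.lintegral_prod_right (Measurable.indicator ?_ hE2)
    exact hf.comp (measurable_fst.prodMk (measurable_advance _ _))
  have h1 : ∫⁻ T in firstRing A w, f (T w 0) (advance A D (T w 0) T) ∂clocksLaw ρ =
      ∫⁻ x, G x ∂expLaw (ρ w) := by
    rw [← lintegral_indicator (measurableSet_firstRing A w), clocksLaw,
      lintegral_pi_update_prepend _ w (hg.indicator (measurableSet_firstRing A w))]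
    refine lintegral_congr fun x => ?_
    rw [hG]
    simp only
    rw [← lintegral_indicator (hE x), clocksLaw]
    refine lintegral_congr fun T => ?_
    by_cases hT : ∀ i ∈ A.erase w, x < T i 0
    · rw [Set.indicator_of_mem ((hfr x T).2 hT), Set.indicator_of_mem (by exact hT),
        Function.update_self, prepend_zero, hadv]
    · rw [Set.indicator_of_notMem (mt (hfr x T).1 hT), Set.indicator_of_notMem (by exact hT)]
  -- A clock of rate `0` shows `⊤`, which is never strictly below a competitor; it cannot win the
  -- race if `A` has another element.
  have hGtop : 0 < ρ w ∨ G ⊤ = 0 := by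
    refine hpos.imp_right fun ⟨i, hi⟩ => ?_
    have : {T : ι → ℕ → ℝ≥0∞ | ∀ i ∈ A.erase w, ⊤ < T i 0} = ∅ := by
      ext T
      simp only [not_top_lt, Set.mem_ofPred_eq, Set.mem_empty_iff_false, iff_false]
      exact fun h => h i hi
    rw [hG]
    simp only [this, Measure.restrict_empty, lintegral_zero_measure]
  rw [h1, lintegral_expLaw (hρ w) hGm hGtop]
  congr 1
  refine lintegral_congr_ae ?_
  filter_upwards [ae_ne_top_lebesgue] with x hx
  rw [hG]
  simp only
  rw [← lintegral_map (g := advance (A.erase w) (D.erase w) x) (hfx x)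
      ((measurable_advance _ _).comp (measurable_const.prodMk measurable_id)),
    map_advance_clocksLaw hρ _ _ (Finset.erase_subset_erase w hD) hx, lintegral_smul_measure,
    smul_eq_mul, ← mul_assoc, ← survival_add_left, Finset.add_sum_erase A ρ (hD hw)]

end Race

/-! ### Configurations as functions of the state and the inputs -/

instance : DecidableEq Clock := fun a b => by
  cases a <;> cases b <;> first | exact isTrue rfl | exact isFalse (by simp)

instance : Fintype Clock where
  elems := {.arrival, .one, .two, .common}
  complete c := by cases c <;> decide

instance : Countable State := by
  have : Function.Injective fun s : State => match s with
      | .empty => (Sum.inl 0 : Fin 3 ⊕ ℕ)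
      | .first => Sum.inl 1
      | .second => Sum.inl 2
      | .both k => Sum.inr k := by
    intro a b h
    cases a <;> cases b <;> simp_all
  exact this.countable

/-- The clocks and the routing decisions. -/
abbrev Inputs := (Clock → ℕ → ℝ≥0∞) × (ℕ → Bool)

/-- The configuration with state `i` and inputs `x`. -/
def configOf (i : State) (x : Inputs) : Config where
  state := i
  arr := x.1 .arrival
  one := x.1 .one
  two := x.1 .two
  common := x.1 .common
  coin := x.2

/-- The clocks of a configuration, as a family. -/
def Config.clocks (c : Config) : Clock → ℕ → ℝ≥0∞
  | .arrival => c.arr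
  | .one => c.one
  | .two => c.two
  | .common => c.common

/-- Pulled back from the product of the fields. The states being countable, measurability on
configurations can be checked one state at a time (`measurable_from_config`). -/
instance : MeasurableSpace Config :=
  MeasurableSpace.comap (fun c => (c.state, (c.clocks, c.coin))) inferInstance

theorem clocks_configOf (i : State) (x : Inputs) : (configOf i x).clocks = x.1 := by
  funext c; cases c <;> rfl

theorem measurable_to_config {α : Type*} [MeasurableSpace α] {f : α → Config}
    (h1 : Measurable fun a => (f a).state) (h2 : Measurable fun a => (f a).clocks)
    (h3 : Measurable fun a => (f a).coin) : Measurable f :=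
  measurable_comap_iff.2 (h1.prodMk (h2.prodMk h3))

@[fun_prop]
theorem measurable_configOf (i : State) : Measurable (configOf i) :=
  measurable_to_config measurable_const (by simp only [clocks_configOf]; fun_prop)
    measurable_snd

@[fun_prop]
theorem measurable_state : Measurable Config.state :=
  measurable_fst.comp (comap_measurable _)

theorem measurable_configOf_uncurry : Measurable fun q : State × Inputs => configOf q.1 q.2 :=
  measurable_from_prod_countable_right fun i => measurable_configOf i

theorem measurable_from_config {α : Type*} [MeasurableSpace α] {f : Config → α}
    (h : ∀ i, Measurable fun x => f (configOf i x)) : Measurable f := by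
  have : f = (fun q : State × Inputs => f (configOf q.1 q.2)) ∘
      fun c => (c.state, (c.clocks, c.coin)) := rfl
  rw [this]
  exact (measurable_from_prod_countable_right h).comp (comap_measurable _)

/-! ### The events of the queue -/

/-- The clocks that run in a given state. -/
def active : State → Finset Clock
  | .empty => {.arrival}
  | .first => {.arrival, .one, .common}
  | .second => {.arrival, .two, .common}
  | .both _ => {.arrival, .one, .two, .common}

/-- The clocks that are discarded when clock `w` rings. -/
def discarded : State → Clock → Finset Clock
  | .first, .one => {.one, .common}
  | .first, .common => {.one, .common}
  | .second, .two => {.two, .common}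
  | .second, .common => {.two, .common}
  | .both _, .common => {.one, .two, .common}
  | _, w => {w}

/-- The state after clock `w` has rung; a customer who has the choice uses the decision `b`. -/
def dest : State → Clock → Bool → State
  | .empty, _, b => route b
  | .first, .arrival, _ => .both 0
  | .first, _, _ => .empty
  | .second, .arrival, _ => .both 0
  | .second, _, _ => .empty
  | .both k, .arrival, _ => .both (k + 1)
  | .both 0, .one, _ => .second
  | .both (k + 1), .one, _ => .both k
  | .both 0, .two, _ => .first
  | .both (k + 1), .two, _ => .both k
  | .both 0, .common, _ => .empty
  | .both 1, .common, b => route b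
  | .both (k + 2), .common, _ => .both k

/-- Whether a routing decision is used when clock `w` rings. -/
def usesCoin : State → Clock → Bool
  | .empty, _ => true
  | .both 1, .common => true
  | _, _ => false

/-- The remaining routing decisions after clock `w` has rung. -/
def coinAfter (i : State) (w : Clock) (b : ℕ → Bool) : ℕ → Bool :=
  if usesCoin i w then renew b else b

theorem discarded_subset {i : State} {w : Clock} (hw : w ∈ active i) :
    discarded i w ⊆ active i := by
  cases i <;> cases w <;> simp [active] at hw <;> simp [active, discarded]

theorem mem_discarded (i : State) (w : Clock) : w ∈ discarded i w := by
  cases i <;> cases w <;> simp [discarded]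

theorem arrival_mem_active (i : State) : .arrival ∈ active i := by
  cases i <;> simp [active]

/-- Allows an unused decision to be averaged over like a used one, so that `jump` needs no
distinction between the two. -/
theorem dest_eq_of_not_usesCoin {i : State} {w : Clock} (h : usesCoin i w = false) (b b' : Bool) :
    dest i w b = dest i w b' := by
  match i, w with
  | .empty, _ => simp [usesCoin] at h
  | .first, w => cases w <;> rfl
  | .second, w => cases w <;> rfl
  | .both 0, w => cases w <;> rfl
  | .both 1, w => cases w <;> first | rfl | simp [usesCoin] at h
  | .both (k + 2), w => cases w <;> rfl

theorem forall_clock {q : Clock → Prop} :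
    (∀ c, q c) ↔ q .arrival ∧ q .one ∧ q .two ∧ q .common :=
  ⟨fun h => ⟨h _, h _, h _, h _⟩, fun ⟨h1, h2, h3, h4⟩ c => by cases c <;> assumption⟩

/-- The sojourn time is a minimum of minima, hence the minimum of all running clocks; in this form
the race lemmas apply to every state alike. -/
theorem lt_sojourn_iff (i : State) (x : Inputs) (t : ℝ≥0∞) :
    t < (configOf i x).sojourn ↔ ∀ c ∈ active i, t < x.1 c 0 := by
  rw [forall_clock]
  cases i <;>
    (simp [Config.sojourn, configOf, Config.serviceOne, Config.serviceTwo, active]; try tauto)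

theorem sojourn_of_firstRing {i : State} {x : Inputs} {w : Clock} (hw : w ∈ active i)
    (h : x.1 ∈ firstRing (active i) w) : (configOf i x).sojourn = x.1 w 0 := by
  refine le_antisymm (not_lt.1 fun hlt => ?_) (not_lt.1 fun hlt => ?_)
  · exact lt_irrefl _ ((lt_sojourn_iff i x _).1 hlt w hw)
  · have := (lt_sojourn_iff i x ((configOf i x).sojourn)).2 fun c hc => ?_
    · exact lt_irrefl _ this
    · by_cases hcw : c = w
      · subst hcw; exact hlt
      · exact hlt.trans (h c (Finset.mem_erase.2 ⟨hcw, hc⟩))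

set_option linter.unusedSimpArgs false in
-- The strict inequalities of `firstRing` select the branch of `Config.next`. With both servers
-- busy, a common clock that rings first equals both service times, so neither is smaller and the
-- branch of simultaneous completion is taken.
theorem next_of_firstRing {i : State} {x : Inputs} {w : Clock} (hw : w ∈ active i)
    (h : x.1 ∈ firstRing (active i) w) :
    (configOf i x).next = configOf (dest i w (x.2 0))
      (advance (active i) (discarded i w) (x.1 w 0) x.1, coinAfter i w x.2) := by
  have hs := sojourn_of_firstRing hw h
  obtain ⟨T, b⟩ := x
  replace h : ∀ c, c ∈ (active i).erase w → T w 0 < T c 0 := h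
  rw [forall_clock] at h
  match i, w with
  | .empty, w =>
    cases w <;> simp [active] at hw
    simp [Config.next, configOf, advance, dest, coinAfter, usesCoin, active, discarded]
  | .first, w =>
    simp only [configOf] at hs ⊢
    cases w <;> simp [active] at hw <;> simp [active] at h <;>
      simp [Config.next, advance, hs, dest, coinAfter, usesCoin, active, discarded,
        Config.serviceOne, h, h.1.le, h.2.le]
  | .second, w =>
    simp only [configOf] at hs ⊢
    cases w <;> simp [active] at hw <;> simp [active] at h <;>
      simp [Config.next, advance, hs, dest, coinAfter, usesCoin, active, discarded,
        Config.serviceTwo, h, h.1.le, h.2.le]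
  | .both k, w =>
    simp only [configOf] at hs ⊢
    cases w <;> simp [active] at h
    · simp [Config.next, advance, hs, dest, coinAfter, usesCoin, active, discarded,
        Config.serviceOne, Config.serviceTwo, h]
    · obtain ⟨h1, h2, h3⟩ := h
      rcases k with _ | _ | k <;>
      simp [Config.next, advance, hs, dest, coinAfter, usesCoin, active, discarded,
        Config.serviceOne, Config.serviceTwo, h1, h2, h3, h1.not_gt, h2.not_gt, h3.not_gt, h1.le,
        h2.le, h3.le]
    · obtain ⟨h1, h2, h3⟩ := h
      rcases k with _ | _ | k <;>
      simp [Config.next, advance, hs, dest, coinAfter, usesCoin, active, discarded,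
        Config.serviceOne, Config.serviceTwo, h1, h2, h3, h1.not_gt, h2.not_gt, h3.not_gt, h1.le,
        h2.le, h3.le]
    · obtain ⟨h1, h2, h3⟩ := h
      rcases k with _ | _ | k <;>
      simp [Config.next, advance, hs, dest, coinAfter, usesCoin, active, discarded,
        Config.serviceOne, Config.serviceTwo, h1, h2, h3, h1.not_gt, h2.not_gt, h3.not_gt, h1.le,
        h2.le, h3.le]

/-- The configuration at time `t` if there is no event until then. -/
noncomputable def Config.shift (t : ℝ≥0∞) (c : Config) : Config :=
  configOf c.state (advance (active c.state) ∅ t c.clocks, c.coin)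

theorem shift_configOf (t : ℝ≥0∞) (i : State) (x : Inputs) :
    (configOf i x).shift t = configOf i (advance (active i) ∅ t x.1, x.2) := by
  rw [Config.shift, clocks_configOf]; rfl

theorem min_tsub_tsub (a b t : ℝ≥0∞) : min (a - t) (b - t) = min a b - t :=
  (Monotone.map_min fun _ _ h => tsub_le_tsub_right h t).symm

theorem Config.sojourn_shift (c : Config) (t : ℝ≥0∞) : (c.shift t).sojourn = c.sojourn - t := by
  rw [Config.shift]
  rcases c with ⟨i, a, o, s, m, b⟩
  cases i <;> simp [Config.sojourn, configOf, Config.serviceOne, Config.serviceTwo, advance, active,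
    elapse, Config.clocks, min_tsub_tsub]

theorem elapse_elapse (s t : ℝ≥0∞) (T : ℕ → ℝ≥0∞) : elapse s (elapse t T) = elapse (t + s) T := by
  funext n; cases n <;> simp [elapse, tsub_add_eq_tsub_tsub]

theorem renew_elapse (t : ℝ≥0∞) (T : ℕ → ℝ≥0∞) : renew (elapse t T) = renew T := rfl

/-- A pathwise fact: subtracting the same `t` from all running clocks preserves the comparisons in
`Config.next`, and the elapsed times `t` and `c.sojourn - t` add up to `c.sojourn`. -/
theorem Config.next_shift {t : ℝ≥0∞} (c : Config) (h : t < c.sojourn) :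
    (c.shift t).next = c.next := by
  have hs : ∀ T, elapse (c.shift t).sojourn (elapse t T) = elapse c.sojourn T := fun T => by
    rw [Config.sojourn_shift, elapse_elapse, add_tsub_cancel_of_le h.le]
  have hlt : ∀ {a b : ℝ≥0∞}, t < a → (a - t < b - t ↔ a < b) := fun ha =>
    (ENNReal.cancel_of_ne h.ne_top).tsub_lt_tsub_iff_right ha.le
  rcases c with ⟨i, a, o, s, m, b⟩
  cases i with
  | empty =>
    simp [Config.next, Config.shift, configOf, active, advance, Config.clocks, renew_elapse]
  | first =>
    have e : Config.shift t ⟨.first, a, o, s, m, b⟩ =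
        ⟨.first, elapse t a, elapse t o, s, elapse t m, b⟩ := by
      simp [Config.shift, configOf, active, advance, Config.clocks]
    rw [e] at hs ⊢
    simp only [Config.sojourn, Config.serviceOne, lt_min_iff] at h
    simp only [Config.next, hs, renew_elapse, Config.serviceOne, elapse, min_tsub_tsub, hlt h.1]
    congr!
  | second =>
    have e : Config.shift t ⟨.second, a, o, s, m, b⟩ =
        ⟨.second, elapse t a, o, elapse t s, elapse t m, b⟩ := by
      simp [Config.shift, configOf, active, advance, Config.clocks]
    rw [e] at hs ⊢
    simp only [Config.sojourn, Config.serviceTwo, lt_min_iff] at h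
    simp only [Config.next, hs, renew_elapse, Config.serviceTwo, elapse, min_tsub_tsub, hlt h.1]
    congr!
  | both k =>
    have e : Config.shift t ⟨.both k, a, o, s, m, b⟩ =
        ⟨.both k, elapse t a, elapse t o, elapse t s, elapse t m, b⟩ := by
      simp [Config.shift, configOf, active, advance, Config.clocks]
    rw [e] at hs ⊢
    simp only [Config.sojourn, Config.serviceOne, Config.serviceTwo] at h
    have h1 : t < min (o 0) (m 0) := (h.trans_le (min_le_right _ _)).trans_le (min_le_left _ _)
    have h2 : t < min (s 0) (m 0) := (h.trans_le (min_le_right _ _)).trans_le (min_le_right _ _)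
    simp only [Config.next, hs, renew_elapse, Config.serviceOne, Config.serviceTwo, elapse,
      min_tsub_tsub, hlt (h.trans_le (min_le_left _ _)), hlt h1, hlt h2]
    congr!

/-! ### Measurability of the sojourn time and of the next configuration. -/

theorem measurable_config_mk {α : Type*} [MeasurableSpace α] {s : α → State}
    {a o t m : α → ℕ → ℝ≥0∞} {b : α → ℕ → Bool} (hs : Measurable s) (ha : Measurable a)
    (ho : Measurable o) (ht : Measurable t) (hm : Measurable m) (hb : Measurable b) :
    Measurable fun x => Config.mk (s x) (a x) (o x) (t x) (m x) (b x) := by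
  refine measurable_to_config hs (measurable_pi_lambda _ fun c => ?_) hb
  cases c <;> assumption

theorem measurable_elapse_comp {α : Type*} [MeasurableSpace α] {s : α → ℝ≥0∞} {T : α → ℕ → ℝ≥0∞}
    (hs : Measurable s) (hT : Measurable T) : Measurable fun x => elapse (s x) (T x) :=
  measurable_elapse.comp (hs.prodMk hT)

@[fun_prop]
theorem measurable_sojourn : Measurable Config.sojourn := by
  refine measurable_from_config fun i => ?_
  cases i <;> simp only [Config.sojourn, configOf, Config.serviceOne, Config.serviceTwo] <;>
    fun_prop

@[fun_prop]
theorem measurable_next : Measurable Config.next := by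
  refine measurable_from_config fun i => ?_
  have hS : Measurable fun x : Inputs => (configOf i x).sojourn := by fun_prop
  have hr : Measurable fun x : Inputs => route (x.2 0) :=
    (measurable_from_top (f := route)).comp (by fun_prop)
  have h1 : Measurable fun x : Inputs => (configOf i x).serviceOne := by
    simp only [configOf, Config.serviceOne]; fun_prop
  have h2 : Measurable fun x : Inputs => (configOf i x).serviceTwo := by
    simp only [configOf, Config.serviceTwo]; fun_prop
  have ha : Measurable fun x : Inputs => (configOf i x).arr 0 := by
    simp only [configOf]; fun_prop
  match i with
  | .empty =>
    refine measurable_config_mk hr ?_ ?_ ?_ ?_ ?_ <;> (simp only [configOf]; fun_prop)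
  | .first =>
    refine Measurable.ite (measurableSet_lt ha h1) (measurable_config_mk ?_ ?_ ?_ ?_ ?_ ?_)
      (measurable_config_mk ?_ ?_ ?_ ?_ ?_ ?_) <;>
    first
    | exact measurable_const
    | exact measurable_elapse_comp hS (by simp only [configOf]; fun_prop)
    | (simp only [configOf]; fun_prop)
  | .second =>
    refine Measurable.ite (measurableSet_lt ha h2) (measurable_config_mk ?_ ?_ ?_ ?_ ?_ ?_)
      (measurable_config_mk ?_ ?_ ?_ ?_ ?_ ?_) <;>
    first
    | exact measurable_const
    | exact measurable_elapse_comp hS (by simp only [configOf]; fun_prop)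
    | (simp only [configOf]; fun_prop)
  | .both k =>
    refine Measurable.ite (measurableSet_lt ha (h1.min h2)) (measurable_config_mk ?_ ?_ ?_ ?_ ?_ ?_)
      (Measurable.ite (measurableSet_lt h1 h2) (measurable_config_mk ?_ ?_ ?_ ?_ ?_ ?_)
      (Measurable.ite (measurableSet_lt h2 h1) (measurable_config_mk ?_ ?_ ?_ ?_ ?_ ?_)
      (measurable_config_mk ?_ ?_ ?_ ?_ ?_ ?_))) <;>
    first
    | exact measurable_const
    | exact measurable_elapse_comp hS (by simp only [configOf]; fun_prop)
    | (rcases k with _ | _ | k <;> first | exact measurable_const | exact hr)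
    | (rcases k with _ | _ | k <;> (simp only [configOf]; fun_prop))

/-! ### The first event -/

section FirstEvent

theorem pairwiseDisjoint_firstRing {ι : Type*} [DecidableEq ι] (A : Finset ι) :
    (A : Set ι).PairwiseDisjoint (firstRing A) := by
  intro v hv w hw hvw
  refine Set.disjoint_left.2 fun T hTv hTw => ?_
  exact lt_asymm (hTv w (Finset.mem_erase.2 ⟨hvw.symm, hw⟩)) (hTw v (Finset.mem_erase.2 ⟨hvw, hv⟩))

theorem lintegral_survival {r : ℝ} (hr : 0 < r) :
    ENNReal.ofReal r * ∫⁻ x, survival r x ∂lebesgue = 1 := by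
  have := lintegral_expLaw hr.le (f := fun _ => 1) measurable_const (.inl hr)
  simpa using this.symm

/-- Ties are excluded by counting mass: the events `firstRing A w` are disjoint and their
probabilities `ρ w * ∫ exp (-r * x) dx`, with `r > 0` the total rate of `A`, add up to `1`. -/
theorem ae_exists_firstRing {ι : Type*} [DecidableEq ι] [Fintype ι] {ρ : ι → ℝ} (hρ : ∀ i, 0 ≤ ρ i)
    {A : Finset ι} {a : ι} (ha : a ∈ A) (hpos : 0 < ρ a) :
    ∀ᵐ T ∂clocksLaw ρ, T ∈ ⋃ w ∈ A, firstRing A w := by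
  refine (mem_ae_iff_prob_eq_one
    (Finset.measurableSet_biUnion _ fun w _ => measurableSet_firstRing A w)).2 ?_
  rw [measure_biUnion_finset (pairwiseDisjoint_firstRing A) fun w _ => measurableSet_firstRing A w]
  have hsum : 0 < ∑ i ∈ A, ρ i :=
    Finset.sum_pos' (fun i _ => hρ i) ⟨a, ha, hpos⟩
  have : ∀ w ∈ A, clocksLaw ρ (firstRing A w) =
      ENNReal.ofReal (ρ w) * ∫⁻ x, survival (∑ i ∈ A, ρ i) x ∂lebesgue := by
    intro w hw
    have h := lintegral_firstRing hρ (Finset.singleton_subset_iff.2 hw)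
      (Finset.mem_singleton_self w)
      (?_ : 0 < ρ w ∨ (A.erase w).Nonempty) (f := fun _ _ => 1) measurable_const
    · simpa using h
    · by_cases haw : a = w
      · exact .inl (haw ▸ hpos)
      · exact .inr ⟨a, Finset.mem_erase.2 ⟨haw, ha⟩⟩
  rw [Finset.sum_congr rfl this, ← Finset.sum_mul, ← ENNReal.ofReal_sum_of_nonneg fun i _ => hρ i,
    lintegral_survival hsum]

variable (ρ : Clock → ℝ) (β : Measure Bool) [IsProbabilityMeasure β]

/-- The law of the inputs, when the clocks have rates `ρ` and the routing decisions have law `β`. -/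
noncomputable def inputsLaw : Measure Inputs := (clocksLaw ρ).prod (iid β)

instance : IsProbabilityMeasure (inputsLaw ρ β) := by unfold inputsLaw; infer_instance

/-- The total rate of the running clocks. -/
def totalRate (i : State) : ℝ := ∑ c ∈ active i, ρ c

/-- The rates of the jumps from state `i`, as a measure on the states. -/
noncomputable def jump (i : State) : Measure State :=
  ∑ w ∈ active i, ENNReal.ofReal (ρ w) • β.map (dest i w)

variable {ρ β}

theorem lintegral_inputsLaw {f : Inputs → ℝ≥0∞} (hf : Measurable f) :
    ∫⁻ x, f x ∂inputsLaw ρ β = ∫⁻ b, ∫⁻ T, f (T, b) ∂clocksLaw ρ ∂iid β :=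
  lintegral_prod_symm _ hf.aemeasurable

theorem totalRate_pos (hρ : ∀ c, 0 ≤ ρ c) (harr : 0 < ρ .arrival) (i : State) :
    0 < totalRate ρ i :=
  Finset.sum_pos' (fun c _ => hρ c) ⟨_, arrival_mem_active i, harr⟩

theorem totalRate_le (hρ : ∀ c, 0 ≤ ρ c) (i : State) : totalRate ρ i ≤ ∑ c, ρ c :=
  Finset.sum_le_sum_of_subset_of_nonneg (Finset.subset_univ _) fun c _ _ => hρ c

theorem jump_univ (hρ : ∀ c, 0 ≤ ρ c) (i : State) :
    jump ρ β i Set.univ = ENNReal.ofReal (totalRate ρ i) := by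
  rw [jump, totalRate, ENNReal.ofReal_sum_of_nonneg fun c _ => hρ c, Measure.finsetSum_apply]
  refine Finset.sum_congr rfl fun w _ => ?_
  rw [Measure.smul_apply, Measure.map_apply .of_discrete .univ, Set.preimage_univ, measure_univ,
    smul_eq_mul, mul_one]

/-- A used decision is the head of an i.i.d. sequence, hence independent of the tail that is left.
An unused one does not influence `dest`, so the extra average over `a` changes nothing. -/
theorem lintegral_coinAfter (i : State) (w : Clock) {f : State → (ℕ → Bool) → ℝ≥0∞}
    (hf : ∀ j, Measurable (f j)) :
    ∫⁻ b, f (dest i w (b 0)) (coinAfter i w b) ∂iid β =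
      ∫⁻ a, ∫⁻ b, f (dest i w a) b ∂iid β ∂β := by
  have hf' : Measurable (Function.uncurry f) := measurable_from_prod_countable_right hf
  cases h : usesCoin i w with
  | true =>
    simp only [coinAfter, h, if_true]
    rw [lintegral_iid]
    · rfl
    · exact hf'.comp (((Measurable.of_discrete (f := dest i w)).comp (measurable_pi_apply 0)).prodMk
        measurable_renew)
  | false =>
    simp only [coinAfter, h, Bool.false_eq_true, if_false]
    have hd := fun b => dest_eq_of_not_usesCoin h b true
    simp only [hd, lintegral_const, measure_univ, mul_one]

/-- The law of the time of the first event and of the configuration just after it: the time is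
exponential, and the clocks are fresh. -/
theorem lintegral_sojourn_next (hρ : ∀ c, 0 ≤ ρ c) (harr : 0 < ρ .arrival) (i : State)
    {F : ℝ≥0∞ → Config → ℝ≥0∞} (hF : Measurable (Function.uncurry F)) :
    ∫⁻ x, F (configOf i x).sojourn (configOf i x).next ∂inputsLaw ρ β =
      ∫⁻ s, survival (totalRate ρ i) s *
        ∫⁻ j, ∫⁻ x, F s (configOf j x) ∂inputsLaw ρ β ∂jump ρ β i ∂lebesgue := by
  have hm : ∀ w, Measurable fun q : ((ℕ → Bool) × ℝ≥0∞) × (Clock → ℕ → ℝ≥0∞) =>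
      F q.1.2 (configOf (dest i w (q.1.1 0)) (q.2, coinAfter i w q.1.1)) := by
    intro w
    refine hF.comp (Measurable.prodMk (by fun_prop) (measurable_configOf_uncurry.comp
      (Measurable.prodMk ((Measurable.of_discrete (f := dest i w)).comp (by fun_prop))
        (Measurable.prodMk (by fun_prop) ?_))))
    unfold coinAfter
    split_ifs
    · exact measurable_renew.comp (by fun_prop)
    · fun_prop
  have hm2 : Measurable fun q : ℝ≥0∞ × State => ∫⁻ x, F q.1 (configOf q.2 x) ∂inputsLaw ρ β := by
    refine Measurable.lintegral_prod_right'
      (f := fun r : (ℝ≥0∞ × State) × Inputs => F r.1.1 (configOf r.1.2 r.2)) ?_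
    exact hF.comp (Measurable.prodMk (by fun_prop)
      (measurable_configOf_uncurry.comp (f := fun r : (ℝ≥0∞ × State) × Inputs => (r.1.2, r.2))
        (by fun_prop)))
  have hfirst : ∀ b : ℕ → Bool, ∫⁻ T, F (configOf i (T, b)).sojourn (configOf i (T, b)).next
      ∂clocksLaw ρ = ∑ w ∈ active i, ENNReal.ofReal (ρ w) * ∫⁻ s, survival (totalRate ρ i) s *
        ∫⁻ T, F s (configOf (dest i w (b 0)) (T, coinAfter i w b)) ∂clocksLaw ρ ∂lebesgue := by
    intro b
    rw [← Measure.restrict_eq_self_of_ae_mem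
      (ae_exists_firstRing hρ (arrival_mem_active i) harr), lintegral_biUnion_finset
      (pairwiseDisjoint_firstRing _) fun w _ => measurableSet_firstRing _ w,
      Measure.restrict_eq_self_of_ae_mem (ae_exists_firstRing hρ (arrival_mem_active i) harr)]
    refine Finset.sum_congr rfl fun w hw => ?_
    rw [totalRate, ← lintegral_firstRing hρ (discarded_subset hw) (mem_discarded i w)
      (f := fun s T => F s (configOf (dest i w (b 0)) (T, coinAfter i w b)))]
    · refine setLIntegral_congr_fun (measurableSet_firstRing _ w) fun T hT => ?_
      have hT' : ((T, b) : Inputs).1 ∈ firstRing (active i) w := hT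
      simp only [sojourn_of_firstRing hw hT', next_of_firstRing hw hT']
    -- The arrival clock runs in every state and has positive rate, so it is a competitor for any
    -- other `w`, possibly of rate `0`.
    · by_cases h : w = .arrival
      · exact .inl (h ▸ harr)
      · exact .inr ⟨.arrival, Finset.mem_erase.2 ⟨Ne.symm h, arrival_mem_active i⟩⟩
    · exact (hm w).comp (f := fun q : ℝ≥0∞ × (Clock → ℕ → ℝ≥0∞) => ((b, q.1), q.2)) (by fun_prop)
  have hcoin : ∀ w s, ∫⁻ b, ∫⁻ T, F s (configOf (dest i w (b 0)) (T, coinAfter i w b)) ∂clocksLaw ρ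
      ∂iid β = ∫⁻ j, ∫⁻ x, F s (configOf j x) ∂inputsLaw ρ β ∂(β.map (dest i w)) := by
    intro w s
    have hF' : ∀ j, Measurable fun x : Inputs => F s (configOf j x) := fun j =>
      hF.comp (measurable_const.prodMk (measurable_configOf j))
    rw [lintegral_map .of_discrete .of_discrete, lintegral_coinAfter i w
      (f := fun j b => ∫⁻ T, F s (configOf j (T, b)) ∂clocksLaw ρ) fun j =>
        Measurable.lintegral_prod_left' (hF' j)]
    simp only [lintegral_inputsLaw (hF' _)]
  have hms : ∀ w, Measurable fun q : (ℕ → Bool) × ℝ≥0∞ => survival (totalRate ρ i) q.2 *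
      ∫⁻ T, F q.2 (configOf (dest i w (q.1 0)) (T, coinAfter i w q.1)) ∂clocksLaw ρ := fun w =>
    Measurable.mul (by fun_prop) (Measurable.lintegral_prod_right' (hm w))
  have hw : ∀ w, ∫⁻ b, ∫⁻ s, survival (totalRate ρ i) s *
        ∫⁻ T, F s (configOf (dest i w (b 0)) (T, coinAfter i w b)) ∂clocksLaw ρ ∂lebesgue ∂iid β =
      ∫⁻ s, survival (totalRate ρ i) s *
        ∫⁻ j, ∫⁻ x, F s (configOf j x) ∂inputsLaw ρ β ∂(β.map (dest i w)) ∂lebesgue := by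
    intro w
    rw [lintegral_lintegral_swap (hms w).aemeasurable]
    refine lintegral_congr fun s => ?_
    rw [lintegral_const_mul', hcoin]
    exact survival_ne_top _ _
  have hmj : ∀ w, Measurable fun s => survival (totalRate ρ i) s *
        ∫⁻ j, ∫⁻ x, F s (configOf j x) ∂inputsLaw ρ β ∂(β.map (dest i w)) := fun w =>
    Measurable.mul (by fun_prop) (Measurable.lintegral_prod_right' hm2)
  rw [lintegral_inputsLaw (f := fun x => F (configOf i x).sojourn (configOf i x).next)
    (hF.comp ((measurable_sojourn.comp (measurable_configOf i)).prodMk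
      (measurable_next.comp (measurable_configOf i))))]
  simp only [hfirst]
  rw [lintegral_finsetSum _ fun w _ => (Measurable.lintegral_prod_right' (hms w)).const_mul _]
  simp only [jump, lintegral_finsetSum_measure, lintegral_smul_measure, Finset.mul_sum, smul_eq_mul]
  rw [lintegral_finsetSum]
  · refine Finset.sum_congr rfl fun w _ => ?_
    rw [lintegral_const_mul' _ _ ENNReal.ofReal_ne_top, hw,
      ← lintegral_const_mul' _ _ ENNReal.ofReal_ne_top]
    refine lintegral_congr fun s => ?_
    ring
  · intro w _
    exact Measurable.mul (by fun_prop)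
      (Measurable.const_mul (Measurable.lintegral_prod_right' hm2) _)

/-- Memorylessness: given that there is no event until `s`, the clocks are fresh at time `s`. -/
theorem inputsLaw_shift (hρ : ∀ c, 0 ≤ ρ c) (i : State) {s : ℝ≥0∞} (hs : s ≠ ⊤) {B : Set Config}
    (hB : MeasurableSet B) :
    inputsLaw ρ β {x | s < (configOf i x).sojourn ∧ (configOf i x).shift s ∈ B} =
      survival (totalRate ρ i) s * inputsLaw ρ β {x | configOf i x ∈ B} := by
  have hmap := congrArg (fun m => m.prod (iid β))
    (map_advance_clocksLaw hρ (active i) ∅ (Finset.empty_subset _) hs)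
  have hadv : Measurable (advance (active i) ∅ s) :=
    (measurable_advance _ _).comp (measurable_const.prodMk measurable_id)
  have hE : MeasurableSet {T : Clock → ℕ → ℝ≥0∞ | ∀ c ∈ active i, s < T c 0} := by
    have : {T : Clock → ℕ → ℝ≥0∞ | ∀ c ∈ active i, s < T c 0} =
        ⋂ c ∈ active i, {T : Clock → ℕ → ℝ≥0∞ | s < T c 0} := by ext; simp
    rw [this]
    exact Finset.measurableSet_biInter _ fun i _ => measurableSet_lt (by fun_prop) (by fun_prop)
  have hB' : MeasurableSet {x | configOf i x ∈ B} := hB.preimage (measurable_configOf i)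
  have hset : {x | s < (configOf i x).sojourn ∧ (configOf i x).shift s ∈ B} =
      (Prod.map (advance (active i) ∅ s) id) ⁻¹' {x | configOf i x ∈ B} ∩
        {T : Clock → ℕ → ℝ≥0∞ | ∀ c ∈ active i, s < T c 0} ×ˢ Set.univ := by
    ext x
    simp only [lt_sojourn_iff, shift_configOf]
    simp only [Set.mem_ofPred_eq, Set.mem_inter_iff, Set.mem_preimage, Set.mem_prod, Set.mem_univ,
      and_true]
    exact and_comm
  rw [hset, ← Measure.restrict_apply (hB'.preimage (hadv.prodMap measurable_id)),
    inputsLaw, ← Measure.prod_restrict, Measure.restrict_univ,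
    ← Measure.map_apply (hadv.prodMap measurable_id) hB', ← Measure.map_prod_map _ _ hadv
      measurable_id, Measure.map_id, hmap, Measure.prod_smul_left, Measure.smul_apply, totalRate,
    smul_eq_mul]

theorem inputsLaw_lt_sojourn (hρ : ∀ c, 0 ≤ ρ c) (i : State) {s : ℝ≥0∞} (hs : s ≠ ⊤) :
    inputsLaw ρ β {x | s < (configOf i x).sojourn} = survival (totalRate ρ i) s := by
  simpa using inputsLaw_shift (β := β) hρ i hs .univ

end FirstEvent

/-! ### Sample paths -/

theorem Config.epoch_zero (c : Config) : c.epoch 0 = 0 := by simp [Config.epoch]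

theorem Config.epoch_succ (c : Config) (n : ℕ) :
    c.epoch (n + 1) = c.sojourn + c.next.epoch n := by
  rw [Config.epoch, Finset.sum_range_succ', add_comm]
  rfl

theorem Config.epoch_one (c : Config) : c.epoch 1 = c.sojourn := by
  rw [Config.epoch_succ, Config.epoch_zero, add_zero]

theorem Config.epoch_mono (c : Config) : Monotone c.epoch := fun _ _ h =>
  Finset.sum_le_sum_of_subset (Finset.range_mono h)

theorem Config.stateAt_eq {c : Config} {t : ℝ≥0} {n : ℕ} (h1 : c.epoch n ≤ t)
    (h2 : t < c.epoch (n + 1)) : c.stateAt t = (Config.next^[n] c).state := by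
  classical
  have h : ∃ n, (t : ℝ≥0∞) < c.epoch (n + 1) := ⟨n, h2⟩
  have : Nat.find h = n := (Nat.find_eq_iff h).2
    ⟨h2, fun m hm => not_lt.2 ((c.epoch_mono (Nat.succ_le_of_lt hm)).trans h1)⟩
  rw [Config.stateAt, dif_pos h]
  convert congrArg (fun k => (Config.next^[k] c).state) this

theorem Config.stateAt_of_forall_le {c : Config} {t : ℝ≥0} (h : ∀ n, c.epoch (n + 1) ≤ t) :
    c.stateAt t = .empty := by
  rw [Config.stateAt, dif_neg]
  exact fun ⟨n, hn⟩ => not_lt.2 (h n) hn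

theorem Config.exists_epoch_le_lt {c : Config} {t : ℝ≥0} (h : ∃ n, (t : ℝ≥0∞) < c.epoch (n + 1)) :
    ∃ n, c.epoch n ≤ t ∧ (t : ℝ≥0∞) < c.epoch (n + 1) := by
  classical
  refine ⟨Nat.find h, ?_, Nat.find_spec h⟩
  rcases hn : Nat.find h with _ | m
  · rw [Config.epoch_zero]; exact zero_le
  · exact not_lt.1 (Nat.find_min h (hn ▸ Nat.lt_succ_self m))

theorem Config.stateAt_of_lt_sojourn {c : Config} {t : ℝ≥0} (h : t < c.sojourn) :
    c.stateAt t = c.state :=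
  Config.stateAt_eq (n := 0) (by rw [Config.epoch_zero]; exact zero_le) (by rwa [Config.epoch_one])

theorem Config.stateAt_congr {c c' : Config} {t t' : ℝ≥0}
    (h : ∀ n, (t : ℝ≥0∞) < c.epoch (n + 1) ↔ (t' : ℝ≥0∞) < c'.epoch (n + 1))
    (hs : ∀ n, (Config.next^[n] c).state = (Config.next^[n] c').state) :
    c.stateAt t = c'.stateAt t' := by
  by_cases hc : ∃ n, (t : ℝ≥0∞) < c.epoch (n + 1)
  · obtain ⟨n, h1, h2⟩ := Config.exists_epoch_le_lt hc
    rw [Config.stateAt_eq h1 h2, hs, Config.stateAt_eq _ ((h n).1 h2)]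
    cases n with
    | zero => rw [Config.epoch_zero]; exact zero_le
    | succ n => exact not_lt.1 fun h' => not_lt.2 h1 ((h n).2 h')
  · push Not at hc
    rw [Config.stateAt_of_forall_le hc, Config.stateAt_of_forall_le fun n =>
      not_lt.1 fun h' => not_lt.2 (hc n) ((h n).2 h')]

theorem Config.epoch_le_iff_of_sojourn_le {c : Config} {t : ℝ≥0} (h : c.sojourn ≤ t) (n : ℕ) :
    c.epoch (n + 1) ≤ t ↔ c.next.epoch n ≤ (t - c.sojourn.toNNReal : ℝ≥0) := by
  have hs : c.sojourn ≠ ⊤ := ne_top_of_le_ne_top ENNReal.coe_ne_top h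
  rw [Config.epoch_succ, ENNReal.coe_sub, ENNReal.coe_toNNReal hs]
  exact (ENNReal.cancel_of_ne hs).le_tsub_iff_left h |>.symm

/-- Restarting at the first event lowers the number of events by one. If the events accumulate by
time `t`, both sides take the default value, so no regularity is required. -/
theorem Config.stateAt_of_sojourn_le {c : Config} {t : ℝ≥0} (h : c.sojourn ≤ t) :
    c.stateAt t = c.next.stateAt (t - c.sojourn.toNNReal) := by
  have key := Config.epoch_le_iff_of_sojourn_le h
  by_cases hc : ∃ n, (t : ℝ≥0∞) < c.epoch (n + 1)
  · obtain ⟨n, h1, h2⟩ := Config.exists_epoch_le_lt hc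
    rcases n with _ | n
    · rw [zero_add, Config.epoch_one] at h2
      exact absurd h2 (not_lt.2 h)
    · rw [Config.stateAt_eq h1 h2, Config.stateAt_eq ((key n).1 h1) (by
        rw [← not_le] at h2 ⊢; exact mt (key (n + 1)).2 h2)]
      rfl
  · push Not at hc
    rw [Config.stateAt_of_forall_le hc, Config.stateAt_of_forall_le fun n => (key (n + 1)).1 (hc _)]

theorem Config.stateAt_shift {c : Config} {t : ℝ≥0} (h : t < c.sojourn) (u : ℝ≥0) :
    (c.shift t).stateAt u = c.stateAt (t + u) := by
  refine Config.stateAt_congr (fun n => ?_) fun n => ?_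
  · rw [Config.epoch_succ, Config.epoch_succ, Config.next_shift c h, Config.sojourn_shift,
      ENNReal.coe_add, (ENNReal.cancel_of_ne ENNReal.coe_ne_top).tsub_add_eq_add_tsub h.le,
      lt_tsub_iff_left]
  · cases n with
    | zero => rfl
    | succ n => rw [Function.iterate_succ_apply, Function.iterate_succ_apply, Config.next_shift c h]

@[fun_prop]
theorem measurable_epoch (n : ℕ) : Measurable fun c : Config => c.epoch n := by
  unfold Config.epoch
  exact Finset.measurable_fun_sum _ fun k _ => measurable_sojourn.comp (measurable_next.iterate k)

/-- Joint measurability in time and configuration is needed because the time left after the first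
event is random. -/
theorem measurable_stateAt : Measurable fun q : ℝ≥0 × Config => q.2.stateAt q.1 := by
  refine measurable_to_countable' fun j => ?_
  have : (fun q : ℝ≥0 × Config => q.2.stateAt q.1) ⁻¹' {j} =
      (⋃ n, {q | q.2.epoch n ≤ q.1} ∩ {q | (q.1 : ℝ≥0∞) < q.2.epoch (n + 1)} ∩
        {q | (Config.next^[n] q.2).state = j}) ∪
      ((⋂ n, {q | q.2.epoch (n + 1) ≤ q.1}) ∩ {_q | State.empty = j}) := by
    ext ⟨t, c⟩
    simp only [Set.mem_preimage, Set.mem_singleton_iff, Set.mem_union, Set.mem_iUnion,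
      Set.mem_inter_iff, Set.mem_ofPred_eq, Set.mem_iInter]
    constructor
    · intro h
      by_cases hc : ∃ n, (t : ℝ≥0∞) < c.epoch (n + 1)
      · obtain ⟨n, h1, h2⟩ := Config.exists_epoch_le_lt hc
        exact .inl ⟨n, ⟨h1, h2⟩, (Config.stateAt_eq h1 h2).symm.trans h⟩
      · push Not at hc
        exact .inr ⟨hc, (Config.stateAt_of_forall_le hc).symm.trans h⟩
    · rintro (⟨n, ⟨h1, h2⟩, h⟩ | ⟨hc, h⟩)
      · rw [Config.stateAt_eq h1 h2, h]
      · rw [Config.stateAt_of_forall_le hc, h]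
  rw [this]
  have hn : ∀ n, Measurable fun q : ℝ≥0 × Config => q.2.epoch n := fun n =>
    (measurable_epoch n).comp measurable_snd
  have ht : Measurable fun q : ℝ≥0 × Config => (q.1 : ℝ≥0∞) := by fun_prop
  refine .union (.iUnion fun n => .inter (.inter ?_ ?_) ?_)
    (.inter (.iInter fun n => ?_) (.const _))
  · exact measurableSet_le (hn n) ht
  · exact measurableSet_lt ht (hn _)
  · exact (measurable_state.comp ((measurable_next.iterate n).comp measurable_snd))
      (measurableSet_singleton j)
  · exact measurableSet_le (hn _) ht

@[fun_prop]
theorem measurable_stateAt_right (t : ℝ≥0) : Measurable fun c : Config => c.stateAt t :=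
  measurable_stateAt.comp (measurable_const.prodMk measurable_id)

/-- The events of a configuration do not accumulate. -/
def Config.Regular (c : Config) : Prop := ∀ t : ℝ≥0, ∃ n, (t : ℝ≥0∞) < c.epoch (n + 1)

theorem Config.Regular.eventually_stateAt_eq {c : Config} (hc : c.Regular) (t : ℝ≥0) :
    ∀ᶠ s in 𝓝[≥] t, c.stateAt s = c.stateAt t := by
  obtain ⟨n, h1, h2⟩ := Config.exists_epoch_le_lt (hc t)
  have hlt : ∀ᶠ s : ℝ≥0 in 𝓝 t, (s : ℝ≥0∞) < c.epoch (n + 1) :=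
    ENNReal.continuous_coe.continuousAt.eventually_lt continuousAt_const h2
  filter_upwards [nhdsWithin_le_nhds hlt, self_mem_nhdsWithin] with s hs hts
  have hts' : (t : ℝ≥0∞) ≤ s := ENNReal.coe_le_coe.2 hts
  rw [Config.stateAt_eq h1 h2, Config.stateAt_eq (h1.trans hts') hs]

/-! ### The Markov property -/

section Markov

variable {ρ : Clock → ℝ} {β : Measure Bool} [IsProbabilityMeasure β]

/-- The first-step decomposition for events after the first event. -/
theorem inputsLaw_first_step (hρ : ∀ c, 0 ≤ ρ c) (harr : 0 < ρ .arrival) (i : State) (t : ℝ≥0)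
    {G : Set (ℝ≥0 × Config)} (hG : MeasurableSet G) :
    inputsLaw ρ β {x | (configOf i x).sojourn ≤ t ∧
        (t - (configOf i x).sojourn.toNNReal, (configOf i x).next) ∈ G} =
      ∫⁻ s, survival (totalRate ρ i) s * ∫⁻ j, (Set.Iic (t : ℝ≥0∞)).indicator
        (fun s => inputsLaw ρ β {x | (t - s.toNNReal, configOf j x) ∈ G}) s
          ∂jump ρ β i ∂lebesgue := by
  have hE : MeasurableSet {q : ℝ≥0∞ × Config | q.1 ≤ t ∧ (t - q.1.toNNReal, q.2) ∈ G} :=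
    (measurableSet_le measurable_fst measurable_const).inter
      (hG.preimage (f := fun q : ℝ≥0∞ × Config => (t - q.1.toNNReal, q.2)) (by fun_prop))
  have h := lintegral_sojourn_next (β := β) hρ harr i
    (F := fun s c => {q : ℝ≥0∞ × Config | q.1 ≤ t ∧ (t - q.1.toNNReal, q.2) ∈ G}.indicator 1 (s, c))
    (measurable_one.indicator hE)
  have hm : Measurable fun x => ((configOf i x).sojourn, (configOf i x).next) :=
    (measurable_sojourn.comp (measurable_configOf i)).prodMk
      (measurable_next.comp (measurable_configOf i))
  rw [← lintegral_indicator_one (s := {x | (configOf i x).sojourn ≤ t ∧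
        (t - (configOf i x).sojourn.toNNReal, (configOf i x).next) ∈ G}) (hE.preimage hm)]
  refine Eq.trans ?_ (h.trans ?_)
  · rfl
  · refine lintegral_congr fun s => ?_
    congr 1
    refine lintegral_congr fun j => ?_
    by_cases hs : s ≤ t
    · rw [Set.indicator_of_mem (show s ∈ Set.Iic (t : ℝ≥0∞) from hs), ← lintegral_indicator_one]
      · refine lintegral_congr fun x => ?_
        have : (s, configOf j x) ∈ {q : ℝ≥0∞ × Config | q.1 ≤ t ∧ (t - q.1.toNNReal, q.2) ∈ G} ↔
            x ∈ {x | (t - s.toNNReal, configOf j x) ∈ G} := and_iff_right hs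
        by_cases hx : x ∈ {x | (t - s.toNNReal, configOf j x) ∈ G}
        · rw [Set.indicator_of_mem hx, Set.indicator_of_mem (this.2 hx)]; rfl
        · rw [Set.indicator_of_notMem hx, Set.indicator_of_notMem (mt this.1 hx)]
      · exact hG.preimage (measurable_const.prodMk (measurable_configOf j))
    · rw [Set.indicator_of_notMem (show s ∉ Set.Iic (t : ℝ≥0∞) from hs)]
      simp [Set.indicator, hs]

/-- The time of the first event is independent of the configuration it leads to; a condition that
ignores the time makes the integral in `inputsLaw_first_step` factorize. -/
theorem inputsLaw_sojourn_le_next (hρ : ∀ c, 0 ≤ ρ c) (harr : 0 < ρ .arrival) (i : State) (t : ℝ≥0)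
    {B : Set Config} (hB : MeasurableSet B) :
    inputsLaw ρ β {x | (configOf i x).sojourn ≤ t ∧ (configOf i x).next ∈ B} =
      (∫⁻ s in Set.Iic (t : ℝ≥0∞), survival (totalRate ρ i) s ∂lebesgue) *
        ∫⁻ j, inputsLaw ρ β {x | configOf j x ∈ B} ∂jump ρ β i := by
  have h := inputsLaw_first_step (β := β) hρ harr i t (G := Prod.snd ⁻¹' B)
    (hB.preimage measurable_snd)
  refine h.trans ?_
  rw [← lintegral_indicator measurableSet_Iic, ← lintegral_mul_const _
    (Measurable.indicator (by fun_prop) measurableSet_Iic)]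
  refine lintegral_congr fun s => ?_
  by_cases hs : s ∈ Set.Iic (t : ℝ≥0∞) <;> simp [hs]

theorem inputsLaw_sojourn_le (hρ : ∀ c, 0 ≤ ρ c) (i : State) (t : ℝ≥0) :
    inputsLaw ρ β {x | (configOf i x).sojourn ≤ t} = 1 - survival (totalRate ρ i) t := by
  have hm : MeasurableSet {x | (t : ℝ≥0∞) < (configOf i x).sojourn} :=
    measurableSet_lt measurable_const (measurable_sojourn.comp (measurable_configOf i))
  rw [← inputsLaw_lt_sojourn (β := β) hρ i ENNReal.coe_ne_top, ← prob_compl_eq_one_sub hm]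
  congr 1
  ext x
  simp

theorem lintegral_Iic_survival (hρ : ∀ c, 0 ≤ ρ c) (harr : 0 < ρ .arrival) (i : State) (t : ℝ≥0) :
    (∫⁻ s in Set.Iic (t : ℝ≥0∞), survival (totalRate ρ i) s ∂lebesgue) *
      ENNReal.ofReal (totalRate ρ i) = 1 - survival (totalRate ρ i) t := by
  -- Both sides are the probability of an event up to `t`. The routing law plays no role, so any
  -- choice of `β` serves.
  rw [← inputsLaw_sojourn_le (β := Measure.dirac true) hρ, ← jump_univ (β := Measure.dirac true) hρ]
  have := inputsLaw_sojourn_le_next (β := Measure.dirac true) hρ harr i t .univ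
  simpa using this.symm

theorem survival_anti {r s : ℝ} (h : r ≤ s) (x : ℝ≥0∞) : survival s x ≤ survival r x :=
  ENNReal.ofReal_le_ofReal (Real.exp_le_exp.2 (neg_le_neg
    (mul_le_mul_of_nonneg_right h ENNReal.toReal_nonneg)))

/-- The total rates are bounded uniformly in the state. Iterated, this excludes accumulation;
applied to a second event, it gives the quadratic error for the rates. -/
theorem inputsLaw_sojourn_le_next_le (hρ : ∀ c, 0 ≤ ρ c) (harr : 0 < ρ .arrival) (i : State)
    (t : ℝ≥0) {B : Set Config} (hB : MeasurableSet B) {K : ℝ≥0∞}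
    (hK : ∀ j, inputsLaw ρ β {x | configOf j x ∈ B} ≤ K) :
    inputsLaw ρ β {x | (configOf i x).sojourn ≤ t ∧ (configOf i x).next ∈ B} ≤
      (1 - survival (∑ c, ρ c) t) * K := by
  rw [inputsLaw_sojourn_le_next hρ harr i t hB]
  calc _ ≤ (∫⁻ s in Set.Iic (t : ℝ≥0∞), survival (totalRate ρ i) s ∂lebesgue) *
        ∫⁻ _, K ∂jump ρ β i := by gcongr; exact hK _
    _ = (1 - survival (totalRate ρ i) t) * K := by
        rw [lintegral_const, jump_univ hρ, ← lintegral_Iic_survival hρ harr]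
        ring
    _ ≤ _ := by gcongr; exact survival_anti (totalRate_le hρ i) _

/-- If `n` events occur up to `t`, each of the `n` sojourn times is at most `t`. Ignoring that the
remaining time shrinks still gives geometric decay. -/
theorem inputsLaw_epoch_le (hρ : ∀ c, 0 ≤ ρ c) (harr : 0 < ρ .arrival) (i : State) (t : ℝ≥0)
    (n : ℕ) :
    inputsLaw ρ β {x | (configOf i x).epoch n ≤ t} ≤ (1 - survival (∑ c, ρ c) t) ^ n := by
  induction n generalizing i with
  | zero => simpa using prob_le_one
  | succ n ih =>
    rw [pow_succ']
    refine le_trans (measure_mono fun x hx => ?_) (inputsLaw_sojourn_le_next_le hρ harr i t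
      (B := {c | c.epoch n ≤ t}) (measurableSet_le (by fun_prop) (by fun_prop)) ih)
    rw [Set.mem_ofPred_eq, Config.epoch_succ] at hx
    exact ⟨le_self_add.trans hx, le_add_self.trans hx⟩

theorem ae_regular (hρ : ∀ c, 0 ≤ ρ c) (harr : 0 < ρ .arrival) (i : State) :
    ∀ᵐ x ∂inputsLaw ρ β, (configOf i x).Regular := by
  have h : ∀ N : ℕ, ∀ᵐ x ∂inputsLaw ρ β, ∃ n, (N : ℝ≥0∞) < (configOf i x).epoch n := by
    intro N
    rw [ae_iff]
    have hlt : 1 - survival (∑ c, ρ c) (N : ℝ≥0) < 1 := by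
      refine ENNReal.sub_lt_self ENNReal.one_ne_top one_ne_zero ?_
      rw [survival]
      positivity
    refine le_antisymm (ge_of_tendsto' (ENNReal.tendsto_pow_atTop_nhds_zero_of_lt_one hlt)
      fun n => ?_) zero_le
    refine le_trans (measure_mono fun x hx => ?_) (inputsLaw_epoch_le (β := β) hρ harr i N n)
    simp only [not_exists, not_lt, Set.mem_ofPred_eq] at hx
    exact_mod_cast hx n
  filter_upwards [ae_all_iff.2 h] with x hx t
  obtain ⟨N, hN⟩ := exists_nat_ge t
  obtain ⟨n, hn⟩ := hx N
  refine ⟨n, lt_of_le_of_lt ?_ (hn.trans_le (Config.epoch_mono _ n.le_succ))⟩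
  exact_mod_cast hN

/-- The paths with `n` events until time `t`, and with state `j` at time `t`. -/
def eventsSet (n : ℕ) (j : State) : Set (ℝ≥0 × Config) :=
  {q | q.2.epoch n ≤ q.1 ∧ (q.1 : ℝ≥0∞) < q.2.epoch (n + 1) ∧ q.2.stateAt q.1 = j}

/-- The paths that, for `k < m`, are in state `s k` at time `t + u k`. -/
def visitSet (m : ℕ) (u : ℕ → ℝ≥0) (s : ℕ → State) : Set (ℝ≥0 × Config) :=
  {q | ∀ k < m, q.2.stateAt (q.1 + u k) = s k}

theorem measurableSet_eventsSet (n : ℕ) (j : State) : MeasurableSet (eventsSet n j) := by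
  have hn : ∀ n, Measurable fun q : ℝ≥0 × Config => q.2.epoch n := fun n =>
    (measurable_epoch n).comp measurable_snd
  have ht : Measurable fun q : ℝ≥0 × Config => (q.1 : ℝ≥0∞) := by fun_prop
  exact (measurableSet_le (hn n) ht).inter ((measurableSet_lt ht (hn _)).inter
    (measurable_stateAt (measurableSet_singleton j)))

theorem measurableSet_visitSet (m : ℕ) (u : ℕ → ℝ≥0) (s : ℕ → State) :
    MeasurableSet (visitSet m u s) := by
  have : visitSet m u s = ⋂ k ∈ Finset.range m,
      (fun q : ℝ≥0 × Config => (q.1 + u k, q.2)) ⁻¹'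
        ((fun q : ℝ≥0 × Config => q.2.stateAt q.1) ⁻¹' {s k}) := by
    ext q; simp [visitSet]
  rw [this]
  exact Finset.measurableSet_biInter _ fun k _ =>
    (measurable_stateAt (measurableSet_singleton _)).preimage (by fun_prop)

theorem mem_eventsSet_succ {c : Config} {t : ℝ≥0} {n : ℕ} {j : State} :
    (t, c) ∈ eventsSet (n + 1) j ↔
      c.sojourn ≤ t ∧ (t - c.sojourn.toNNReal, c.next) ∈ eventsSet n j := by
  by_cases h : c.sojourn ≤ t
  · have key := Config.epoch_le_iff_of_sojourn_le h
    simp only [eventsSet, Set.mem_ofPred_eq, h, true_and, key, ← not_le,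
      ← Config.stateAt_of_sojourn_le h]
  · refine ⟨fun h' => absurd ?_ h, fun h' => absurd h'.1 h⟩
    exact (c.epoch_one ▸ c.epoch_mono (Nat.le_add_left 1 n)).trans h'.1

theorem mem_visitSet_of_sojourn_le {c : Config} {t : ℝ≥0} (h : c.sojourn ≤ t) {m : ℕ}
    {u : ℕ → ℝ≥0} {s : ℕ → State} :
    (t, c) ∈ visitSet m u s ↔ (t - c.sojourn.toNNReal, c.next) ∈ visitSet m u s := by
  refine forall₂_congr fun k _ => ?_
  have hs : c.sojourn ≠ ⊤ := ne_top_of_le_ne_top ENNReal.coe_ne_top h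
  have h' : c.sojourn.toNNReal ≤ t := by
    rw [← ENNReal.coe_le_coe, ENNReal.coe_toNNReal hs]; exact h
  rw [Config.stateAt_of_sojourn_le (t := t + u k)
    (h.trans (ENNReal.coe_le_coe.2 le_self_add)), tsub_add_eq_add_tsub h']

/-- Induction on the number of events, for all `i` and `t` at once: the first event leads to another
state with less time left. The last factor depends on `j` only, so it comes out of the integrals
over the first event. -/
theorem inputsLaw_events_visit (hρ : ∀ c, 0 ≤ ρ c) (harr : 0 < ρ .arrival) (n : ℕ) (i j : State)
    (t : ℝ≥0) (m : ℕ) (u : ℕ → ℝ≥0) (s : ℕ → State) :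
    inputsLaw ρ β {x | (t, configOf i x) ∈ eventsSet n j ∩ visitSet m u s} =
      inputsLaw ρ β {x | (t, configOf i x) ∈ eventsSet n j} *
        inputsLaw ρ β {x | (0, configOf j x) ∈ visitSet m u s} := by
  induction n generalizing i t with
  | zero =>
    have h0 : ∀ c : Config, (t, c) ∈ eventsSet 0 j ↔ t < c.sojourn ∧ c.state = j := by
      intro c
      simp only [eventsSet, Set.mem_ofPred_eq, Config.epoch_zero, zero_add, Config.epoch_one,
        zero_le, true_and]
      exact and_congr_right fun h => by rw [Config.stateAt_of_lt_sojourn h]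
    -- Without an event the state at `t` is still `i`; for `i ≠ j` both sides vanish.
    by_cases hij : i = j
    · subst hij
      have h1 : {x | (t, configOf i x) ∈ eventsSet 0 i} = {x | t < (configOf i x).sojourn} := by
        ext x; simp only [Set.mem_ofPred_eq, h0]; exact and_iff_left rfl
      have h2 : {x | (t, configOf i x) ∈ eventsSet 0 i ∩ visitSet m u s} =
          {x | t < (configOf i x).sojourn ∧
            (configOf i x).shift t ∈ {c | (0, c) ∈ visitSet m u s}} := by
        ext x
        simp only [Set.mem_ofPred_eq, Set.mem_inter_iff, h0]
        have : t < (configOf i x).sojourn ∧ (configOf i x).state = i ↔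
          t < (configOf i x).sojourn := and_iff_left rfl
        rw [this]
        refine and_congr_right fun h => forall₂_congr fun k _ => ?_
        simp only [zero_add, Config.stateAt_shift h]
      rw [h1, h2, inputsLaw_lt_sojourn hρ i ENNReal.coe_ne_top, inputsLaw_shift hρ i
        ENNReal.coe_ne_top (B := {c | (0, c) ∈ visitSet m u s})
        ((measurableSet_visitSet m u s).preimage (f := fun c : Config => ((0 : ℝ≥0), c))
          (by fun_prop))]
      rfl
    · have hne : ∀ x, (configOf i x).state ≠ j := fun x => hij
      simp [h0, hne]
  | succ n ih =>
    have h1 : {x | (t, configOf i x) ∈ eventsSet (n + 1) j} =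
        {x | (configOf i x).sojourn ≤ t ∧
          (t - (configOf i x).sojourn.toNNReal, (configOf i x).next) ∈ eventsSet n j} := by
      ext x; exact mem_eventsSet_succ
    have h2 : {x | (t, configOf i x) ∈ eventsSet (n + 1) j ∩ visitSet m u s} =
        {x | (configOf i x).sojourn ≤ t ∧
          (t - (configOf i x).sojourn.toNNReal, (configOf i x).next) ∈
            eventsSet n j ∩ visitSet m u s} := by
      ext x
      simp only [Set.mem_ofPred_eq, Set.mem_inter_iff, mem_eventsSet_succ, and_assoc]
      exact and_congr_right fun h => and_congr_right fun _ => mem_visitSet_of_sojourn_le h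
    have hK : inputsLaw ρ β {x | (0, configOf j x) ∈ visitSet m u s} ≠ ⊤ := measure_ne_top _ _
    rw [h1, h2, inputsLaw_first_step hρ harr i t ((measurableSet_eventsSet n j).inter
        (measurableSet_visitSet m u s)),
      inputsLaw_first_step hρ harr i t (measurableSet_eventsSet n j), ← lintegral_mul_const' _ _ hK]
    refine lintegral_congr fun r => ?_
    rw [mul_assoc, ← lintegral_mul_const' _ _ hK]
    congr 1
    refine lintegral_congr fun k => ?_
    rw [← Set.indicator_mul_const]
    simp only [ih]

/-- The Markov property at time `t`, for fresh clocks at time `0`. -/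
theorem inputsLaw_markov (hρ : ∀ c, 0 ≤ ρ c) (harr : 0 < ρ .arrival) (i j : State)
    (t : ℝ≥0) (m : ℕ) (u : ℕ → ℝ≥0) (s : ℕ → State) :
    inputsLaw ρ β {x | (configOf i x).stateAt t = j ∧
        ∀ k < m, (configOf i x).stateAt (t + u k) = s k} =
      inputsLaw ρ β {x | (configOf i x).stateAt t = j} *
        inputsLaw ρ β {x | ∀ k < m, (configOf j x).stateAt (u k) = s k} := by
  -- The decomposition by the number of events holds only almost surely: it misses the paths whose
  -- events accumulate by time `t`, where `stateAt` has its default value.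
  have hmeas : ∀ V : Set (ℝ≥0 × Config), MeasurableSet V →
      inputsLaw ρ β {x | (configOf i x).stateAt t = j ∧ (t, configOf i x) ∈ V} =
        ∑' n, inputsLaw ρ β {x | (t, configOf i x) ∈ eventsSet n j ∩ V} := by
    intro V hV
    rw [← measure_iUnion]
    · refine measure_congr ?_
      filter_upwards [ae_regular hρ harr i] with x hx
      refine propext ⟨fun ⟨h, hV⟩ => ?_, fun h => ?_⟩
      · obtain ⟨n, h1, h2⟩ := Config.exists_epoch_le_lt (hx t)
        exact Set.mem_iUnion.2 ⟨n, ⟨h1, h2, h⟩, hV⟩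
      · obtain ⟨n, ⟨_, _, h⟩, hV⟩ := Set.mem_iUnion.1 h
        exact ⟨h, hV⟩
    · intro k l hkl
      refine Set.disjoint_left.2 fun x hk hl => hkl ?_
      have key : ∀ {a b : ℕ}, (t, configOf i x) ∈ eventsSet a j →
          (t, configOf i x) ∈ eventsSet b j → a ≤ b := fun ha hb => by
        by_contra! hlt
        exact absurd (hb.2.1.trans_le (Config.epoch_mono _ hlt)) (not_lt.2 ha.1)
      exact le_antisymm (key hk.1 hl.1) (key hl.1 hk.1)
    · intro n
      exact ((measurableSet_eventsSet n j).inter hV).preimage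
        (measurable_const.prodMk (measurable_configOf i))
  have h1 := hmeas _ (measurableSet_visitSet m u s)
  have h2 := hmeas Set.univ .univ
  simp only [Set.mem_univ, and_true, Set.inter_univ] at h2
  have h3 : {x | ∀ k < m, (configOf j x).stateAt (u k) = s k} =
      {x | (0, configOf j x) ∈ visitSet m u s} := by
    simp [visitSet]
  rw [h2, h3, ← ENNReal.tsum_mul_right]
  simp only [← inputsLaw_events_visit hρ harr]
  exact h1

end Markov

/-! ### The transition function -/

section Transition

variable {ρ : Clock → ℝ} {β : Measure Bool} [IsProbabilityMeasure β]

theorem hasSum_measureReal_fiber {α S : Type*} [MeasurableSpace α] [MeasurableSpace S]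
    [MeasurableSingletonClass S] [Countable S] {μ : Measure α} [IsFiniteMeasure μ] {f : α → S}
    (hf : Measurable f) {A : Set α} (hA : MeasurableSet A) :
    HasSum (fun j => μ.real {x | f x = j ∧ x ∈ A}) (μ.real A) := by
  have h : μ A = ∑' j, μ {x | f x = j ∧ x ∈ A} := by
    rw [← measure_iUnion]
    · congr 1
      ext x
      simp
    · exact fun j k hjk => Set.disjoint_left.2 fun x hj hk => hjk (hj.1.symm.trans hk.1)
    · exact fun j => (hf (measurableSet_singleton j)).inter hA
  have hne : ∀ j, μ {x | f x = j ∧ x ∈ A} ≠ ⊤ := fun j => measure_ne_top _ _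
  have := ENNReal.hasSum_toReal (f := fun j => μ {x | f x = j ∧ x ∈ A})
    (h ▸ measure_ne_top _ _)
  rwa [← ENNReal.tsum_toReal_eq hne, ← h] at this

variable (ρ β) in
/-- The transition function of the queue. -/
noncomputable def transition (t : ℝ≥0) (i j : State) : ℝ :=
  (inputsLaw ρ β).real {x | (configOf i x).stateAt t = j}

theorem measurable_stateAt_configOf (t : ℝ≥0) (i : State) :
    Measurable fun x => (configOf i x).stateAt t :=
  (measurable_stateAt_right t).comp (measurable_configOf i)

theorem isTransitionFunction_transition (hρ : ∀ c, 0 ≤ ρ c) (harr : 0 < ρ .arrival) :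
    IsTransitionFunction (transition ρ β) where
  nonneg _ _ _ := measureReal_nonneg
  hasSum_one t i := by
    have := hasSum_measureReal_fiber (μ := inputsLaw ρ β) (measurable_stateAt_configOf t i) .univ
    simp only [Set.mem_univ, and_true, probReal_univ] at this
    exact this
  zero i j := by
    have h : ∀ᵐ x ∂inputsLaw ρ β, (configOf i x).stateAt 0 = i := by
      have h0 : ∀ᵐ x ∂inputsLaw ρ β, 0 < (configOf i x).sojourn := by
        refine (mem_ae_iff_prob_eq_one ?_).2 ?_
        · exact measurableSet_lt measurable_const (measurable_sojourn.comp (measurable_configOf i))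
        · exact (inputsLaw_lt_sojourn hρ i ENNReal.zero_ne_top).trans (by simp [survival])
      filter_upwards [h0] with x hx
      exact Config.stateAt_of_lt_sojourn hx
    split_ifs with hij
    · subst hij
      have : {x | (configOf i x).stateAt 0 = i} =ᵐ[inputsLaw ρ β] Set.univ := by
        filter_upwards [h] with x hx using propext ⟨fun _ => trivial, fun _ => hx⟩
      rw [transition, measureReal_congr this, probReal_univ]
    · have : {x | (configOf i x).stateAt 0 = j} =ᵐ[inputsLaw ρ β] (∅ : Set Inputs) := by
        filter_upwards [h] with x hx using propext ⟨fun h' => hij (hx.symm.trans h'), False.elim⟩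
      rw [transition, measureReal_congr this, measureReal_empty]
  add s t i j := by
    -- Total probability over the state at time `s`; the Markov property with one later time then
    -- factorizes each term.
    have h := hasSum_measureReal_fiber (μ := inputsLaw ρ β) (measurable_stateAt_configOf s i)
      (A := {x | (configOf i x).stateAt (s + t) = j})
      (measurable_stateAt_configOf (s + t) i (measurableSet_singleton j))
    refine h.congr_fun fun k => ?_
    have := congrArg ENNReal.toReal
      (inputsLaw_markov (β := β) hρ harr i k s 1 (fun _ => t) fun _ => j)
    simp only [Nat.lt_one_iff, forall_eq, ENNReal.toReal_mul] at this
    exact this.symm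

/-- The Markov property splits off the first factor, and the rest is a path started afresh from `s
1` at time `u 1`. Hence the induction runs over shifted sequences. -/
theorem inputsLaw_real_path (hρ : ∀ c, 0 ≤ ρ c) (harr : 0 < ρ .arrival) (m : ℕ) {u : ℕ → ℝ≥0}
    (hu : Monotone u) (s : ℕ → State) :
    (inputsLaw ρ β).real {x | ∀ k < m, (configOf (s 0) x).stateAt (u (k + 1) - u 0) = s (k + 1)} =
      ∏ k ∈ Finset.range m, transition ρ β (u (k + 1) - u k) (s k) (s (k + 1)) := by
  induction m generalizing u s with
  | zero => simp
  | succ m ih =>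
    rw [Finset.prod_range_succ', mul_comm, ← ih (u := fun k => u (k + 1)) (s := fun k => s (k + 1))
      fun a b hab => hu (Nat.succ_le_succ hab)]
    have h := congrArg ENNReal.toReal (inputsLaw_markov (β := β) hρ harr (s 0) (s 1) (u 1 - u 0) m
      (fun k => u (k + 2) - u 1) fun k => s (k + 2))
    rw [ENNReal.toReal_mul] at h
    refine Eq.trans ?_ h
    rw [measureReal_def]
    congr 2
    ext x
    simp only [Set.mem_ofPred_eq]
    rw [Nat.forall_lt_succ_left]
    refine and_congr Iff.rfl (forall₂_congr fun k _ => ?_)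
    rw [add_comm (u 1 - u 0), tsub_add_tsub_cancel (hu (by omega)) (hu (by omega))]

/-! ### The transition rates -/

theorem tendsto_one_sub_exp_div (r : ℝ) :
    Tendsto (fun h : ℝ≥0 => (1 - Real.exp (-(r * h))) / (h : ℝ)) (𝓝[>] 0) (𝓝 r) := by
  have hd : HasDerivAt (fun x : ℝ => -Real.exp (-(r * x))) r 0 := by
    simpa using hasDerivAt_neg_exp_mul_exp (r := r) (x := 0)
  have hc : Tendsto (fun h : ℝ≥0 => (h : ℝ)) (𝓝[>] 0) (𝓝[≠] 0) := by
    refine tendsto_nhdsWithin_iff.2 ⟨?_, ?_⟩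
    · exact (NNReal.continuous_coe.tendsto' 0 0 rfl).mono_left nhdsWithin_le_nhds
    · filter_upwards [self_mem_nhdsWithin] with h hh
      simpa using (ne_of_gt hh : h ≠ 0)
  refine (hd.tendsto_slope.comp hc).congr fun h => ?_
  simp [slope_def_field]
  ring

theorem toReal_one_sub_survival {r : ℝ} (hr : 0 ≤ r) (h : ℝ≥0) :
    (1 - survival r h).toReal = 1 - Real.exp (-(r * h)) := by
  have : Real.exp (-(r * h)) ≤ 1 := Real.exp_le_one_iff.2 (by simpa using by positivity)
  rw [survival, ENNReal.coe_toReal, ENNReal.toReal_sub_of_le _ ENNReal.one_ne_top,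
    ENNReal.toReal_one, ENNReal.toReal_ofReal (by positivity)]
  simpa using this

/-- The approximation adds the probability of no event to that of a first event leading to `j`. It
can only be wrong if a second event follows in time. -/
theorem abs_transition_sub_le (hρ : ∀ c, 0 ≤ ρ c) (harr : 0 < ρ .arrival) (i j : State) (h : ℝ≥0) :
    |transition ρ β h i j - ((if i = j then Real.exp (-(totalRate ρ i * h)) else 0) +
        (1 - Real.exp (-(totalRate ρ i * h))) / totalRate ρ i * (jump ρ β i).real {j})| ≤
      ((∑ c, ρ c) * h) ^ 2 := by
  set μ := inputsLaw ρ β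
  have hr := totalRate_pos hρ harr i
  have hR : 0 ≤ ∑ c, ρ c := Finset.sum_nonneg fun c _ => hρ c
  have hS : Measurable fun x => (configOf i x).sojourn :=
    measurable_sojourn.comp (measurable_configOf i)
  have hlt : MeasurableSet {x | (h : ℝ≥0∞) < (configOf i x).sojourn} :=
    measurableSet_lt measurable_const hS
  have hnone : μ.real ({x | (configOf i x).stateAt h = j} ∩
      {x | (h : ℝ≥0∞) < (configOf i x).sojourn}) =
      if i = j then Real.exp (-(totalRate ρ i * h)) else 0 := by
    have hs : {x | (configOf i x).stateAt h = j} ∩ {x | (h : ℝ≥0∞) < (configOf i x).sojourn} =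
        {x | i = j ∧ (h : ℝ≥0∞) < (configOf i x).sojourn} := by
      ext x
      refine and_congr_left fun hx => ?_
      rw [Set.mem_ofPred_eq, Config.stateAt_of_lt_sojourn hx]
      rfl
    rw [hs]
    split_ifs with hij
    · simp only [hij, true_and]
      rw [← hij, measureReal_def, inputsLaw_lt_sojourn hρ i ENNReal.coe_ne_top, survival,
        ENNReal.toReal_ofReal (by positivity)]
      rfl
    · simp [hij]
  -- `B` replaces the state at time `h` in `A` by the state just after the first event. `E` contains
  -- all paths with two events up to `h`, so `A` and `B` agree outside `E`.
  set A := {x | (configOf i x).stateAt h = j} ∩ {x | (configOf i x).sojourn ≤ h}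
  set B := {x | (configOf i x).sojourn ≤ h ∧ (configOf i x).next ∈ {c | c.state = j}}
  set E := {x | (configOf i x).sojourn ≤ h ∧ (configOf i x).next ∈ {c | c.sojourn ≤ (h : ℝ≥0∞)}}
  have hsplit : transition ρ β h i j =
      (if i = j then Real.exp (-(totalRate ρ i * h)) else 0) + μ.real A := by
    rw [← hnone, transition, ← measureReal_inter_add_sdiff hlt]
    congr 2
    ext x
    simp [A]
  have hB : μ.real B = (1 - Real.exp (-(totalRate ρ i * h))) / totalRate ρ i *
      (jump ρ β i).real {j} := by
    have h1 := inputsLaw_sojourn_le_next (β := β) hρ harr i h (B := {c | c.state = j})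
      (measurable_state (measurableSet_singleton j))
    have h2 := congrArg ENNReal.toReal (lintegral_Iic_survival hρ harr i h)
    have h3 : ∫⁻ k, inputsLaw ρ β {x | configOf k x ∈ {c | c.state = j}} ∂jump ρ β i =
        jump ρ β i {j} := by
      rw [← lintegral_indicator_one (measurableSet_singleton j)]
      refine lintegral_congr fun k => ?_
      by_cases hk : k = j <;> simp [configOf, hk]
    rw [ENNReal.toReal_mul, ENNReal.toReal_ofReal hr.le, toReal_one_sub_survival hr.le] at h2
    rw [measureReal_def, measureReal_def, ← h2, mul_div_cancel_right₀ _ hr.ne']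
    rw [h3] at h1
    rw [← ENNReal.toReal_mul]
    exact congrArg ENNReal.toReal h1
  have hE : μ.real E ≤ ((∑ c, ρ c) * h) ^ 2 := by
    have hb : ∀ j, inputsLaw ρ β {x | configOf j x ∈ {c | c.sojourn ≤ (h : ℝ≥0∞)}} ≤
        1 - survival (∑ c, ρ c) h := fun j =>
      (inputsLaw_sojourn_le hρ j h).trans_le
        (tsub_le_tsub_left (survival_anti (totalRate_le hρ j) _) _)
    have h1 := inputsLaw_sojourn_le_next_le (β := β) hρ harr i h
      (measurableSet_le measurable_sojourn measurable_const) hb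
    have h2 := ENNReal.toReal_mono (by finiteness) h1
    rw [ENNReal.toReal_mul, toReal_one_sub_survival hR, ← sq] at h2
    refine h2.trans (pow_le_pow_left₀ ?_ ?_ 2)
    · rw [← toReal_one_sub_survival hR]; exact ENNReal.toReal_nonneg
    · linarith [Real.one_sub_le_exp_neg ((∑ c, ρ c) * h)]
  have hAB : ∀ x, x ∉ E → (x ∈ A ↔ x ∈ B) := by
    intro x hx
    have hx' : (configOf i x).sojourn ≤ h → (h : ℝ≥0∞) < (configOf i x).next.sojourn :=
      fun h1 => not_le.1 fun h2 => hx ⟨h1, h2⟩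
    refine and_comm.trans (and_congr_right fun h1 => ?_)
    have h1' : (configOf i x).sojourn ≤ h := h1
    rw [Set.mem_ofPred_eq, Config.stateAt_of_sojourn_le h1', Config.stateAt_of_lt_sojourn]
    · rfl
    · exact lt_of_le_of_lt (ENNReal.coe_le_coe.2 tsub_le_self) (hx' h1')
  have h1 : μ.real A ≤ μ.real B + μ.real E :=
    (measureReal_mono fun x hx => by
      by_cases hxE : x ∈ E
      · exact Or.inr hxE
      · exact Or.inl ((hAB x hxE).1 hx)).trans (measureReal_union_le _ _)
  have h2 : μ.real B ≤ μ.real A + μ.real E :=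
    (measureReal_mono fun x hx => by
      by_cases hxE : x ∈ E
      · exact Or.inr hxE
      · exact Or.inl ((hAB x hxE).2 hx)).trans (measureReal_union_le _ _)
  rw [hsplit, ← hB, abs_le]
  constructor <;> linarith

theorem hasRateMatrix_transition (hρ : ∀ c, 0 ≤ ρ c) (harr : 0 < ρ .arrival) :
    HasRateMatrix (transition ρ β) fun i j =>
      (jump ρ β i).real {j} - if i = j then totalRate ρ i else 0 := by
  intro i j
  have hr := totalRate_pos hρ harr i
  set r := totalRate ρ i
  set R := ∑ c, ρ c
  set J := (jump ρ β i).real {j}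
  set a : ℝ≥0 → ℝ := fun h => (if i = j then Real.exp (-(r * h)) else 0) +
    (1 - Real.exp (-(r * h))) / r * J
  have hφ := tendsto_one_sub_exp_div r
  have hmain : Tendsto (fun h : ℝ≥0 => (a h - if i = j then 1 else 0) / (h : ℝ)) (𝓝[>] 0)
      (𝓝 (J - if i = j then r else 0)) := by
    have h1 := (hφ.mul_const (J / r)).sub (hφ.mul_const (if i = j then 1 else 0))
    have e : r * (J / r) - r * (if i = j then 1 else 0) = J - if i = j then r else 0 := by
      rw [mul_div_cancel₀ _ hr.ne', mul_ite, mul_one, mul_zero]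
    rw [e] at h1
    refine h1.congr fun h => ?_
    simp only [a]
    split_ifs <;> ring
  have herr : Tendsto (fun h : ℝ≥0 => (transition ρ β h i j - a h) / (h : ℝ)) (𝓝[>] 0) (𝓝 0) := by
    have hlim : Tendsto (fun h : ℝ≥0 => R ^ 2 * (h : ℝ)) (𝓝[>] 0) (𝓝 0) := by
      have : Continuous fun h : ℝ≥0 => R ^ 2 * (h : ℝ) := by fun_prop
      exact (this.tendsto' 0 0 (by simp)).mono_left nhdsWithin_le_nhds
    refine squeeze_zero_norm' ?_ hlim
    filter_upwards [self_mem_nhdsWithin] with h hh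
    have hh' : (0 : ℝ) < h := NNReal.coe_pos.2 hh
    rw [Real.norm_eq_abs, abs_div, abs_of_pos hh', div_le_iff₀ hh']
    refine (abs_transition_sub_le hρ harr i j h).trans_eq ?_
    ring
  have := hmain.add herr
  rw [add_zero] at this
  refine this.congr fun h => ?_
  ring

theorem jump_real_singleton (hρ : ∀ c, 0 ≤ ρ c) (i j : State) :
    (jump ρ β i).real {j} = ∑ w ∈ active i, ρ w *
      ((if dest i w true = j then β.real {true} else 0) +
        if dest i w false = j then 1 - β.real {true} else 0) := by
  have hf : β.real {false} = 1 - β.real {true} := by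
    rw [← probReal_compl_eq_one_sub (measurableSet_singleton true)]
    congr 1
    ext b; cases b <;> simp
  rw [jump, measureReal_def, Measure.finsetSum_apply, ENNReal.toReal_sum]
  · refine Finset.sum_congr rfl fun w _ => ?_
    rw [Measure.smul_apply, smul_eq_mul, ENNReal.toReal_mul, ENNReal.toReal_ofReal (hρ w),
      Measure.map_apply .of_discrete (measurableSet_singleton j), ← measureReal_def, ← hf]
    congr 1
    rw [← integral_indicator_one .of_discrete, integral_fintype (.of_finite)]
    by_cases h1 : dest i w true = j <;> by_cases h2 : dest i w false = j <;> simp [h1, h2]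
  · intro w _
    rw [Measure.smul_apply, smul_eq_mul]
    have := measure_ne_top (β.map (dest i w)) {j}
    finiteness

theorem rateMatrix_eq {lam mu1 mu2 mu12 p : ℝ} (hlam : 0 ≤ lam) (hmu1 : 0 ≤ mu1) (hmu2 : 0 ≤ mu2)
    (hmu12 : 0 ≤ mu12) (hβ : β.real {true} = p) (i j : State) :
    rateMatrix lam mu1 mu2 mu12 p i j =
      (jump (Clock.rate lam mu1 mu2 mu12) β i).real {j} -
        if i = j then totalRate (Clock.rate lam mu1 mu2 mu12) i else 0 := by
  rw [jump_real_singleton (fun c => by cases c <;> assumption), hβ, totalRate]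
  -- With both servers busy, the cases of no, one, and at least two waiting customers are separated,
  -- since `dest` treats them differently.
  rcases i with _ | _ | _ | _ | _ | k <;> rcases j with _ | _ | _ | _ | l <;>
    simp [rateMatrix, active, dest, route, Clock.rate] <;> first
    | ring1
    | (simp only [@eq_comm ℕ _ l]; split_ifs <;> first | omega | ring1)
    | (split_ifs <;> first | omega | ring1)

end Transition

/-! ### The random queue -/

section Queue

variable {Ω : Type*} {D : Input Ω}

/-- The clocks and the routing decisions of the queue. -/
def Input.inputs (D : Input Ω) (ω : Ω) : Inputs := (fun c n => D.clock c n ω, fun n => D.coin n ω)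

variable [MeasurableSpace Ω] {P : Measure Ω} {lam mu1 mu2 mu12 p : ℝ}

theorem Input.IsMMD2.measurable_inputs (hD : D.IsMMD2 P lam mu1 mu2 mu12 p) :
    Measurable D.inputs :=
  (measurable_pi_lambda _ fun c => measurable_pi_lambda _ fun n => hD.measurable_clock c n).prodMk
    (measurable_pi_lambda _ fun n => hD.measurable_coin n)

theorem Input.IsMMD2.measurable_config (hD : D.IsMMD2 P lam mu1 mu2 mu12 p) :
    Measurable D.config :=
  measurable_configOf_uncurry.comp (hD.measurable_init.prodMk hD.measurable_inputs)

variable [IsProbabilityMeasure P]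

theorem Input.IsMMD2.map_coin (hD : D.IsMMD2 P lam mu1 mu2 mu12 p) (n : ℕ) :
    P.map (D.coin n) = P.map (D.coin 0) := by
  have h : ∀ n, P.map (D.coin n) {true} = ENNReal.ofReal p := fun n => by
    rw [Measure.map_apply (hD.measurable_coin n) (measurableSet_singleton true)]
    exact hD.law_coin n
  have hprob : ∀ n, IsProbabilityMeasure (P.map (D.coin n)) := fun n =>
    Measure.isProbabilityMeasure_map (hD.measurable_coin n).aemeasurable
  have h' : ∀ n, P.map (D.coin n) {false} = 1 - ENNReal.ofReal p := fun n => by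
    rw [← h n, ← prob_compl_eq_one_sub (measurableSet_singleton true)]
    congr 1
    ext b; cases b <;> simp
  refine Measure.ext_of_singleton fun b => ?_
  cases b
  · rw [h', h']
  · rw [h, h]

/-- Currying turns the independent family indexed by `Clock × ℕ` into four independent i.i.d.
sequences. -/
theorem Input.IsMMD2.map_inputs (hD : D.IsMMD2 P lam mu1 mu2 mu12 p)
    [IsProbabilityMeasure (P.map (D.coin 0))] :
    P.map D.inputs = inputsLaw (Clock.rate lam mu1 mu2 mu12) (P.map (D.coin 0)) := by
  have hmc : Measurable fun ω (i : Clock × ℕ) => D.clock i.1 i.2 ω :=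
    measurable_pi_lambda _ fun i => hD.measurable_clock i.1 i.2
  have hmb : Measurable fun ω n => D.coin n ω := measurable_pi_lambda _ hD.measurable_coin
  have hcl : P.map (fun ω c n => D.clock c n ω) = clocksLaw (Clock.rate lam mu1 mu2 mu12) := by
    have h := hD.indep_clock.map_fun_eq_infinitePi_map
      fun i : Clock × ℕ => hD.measurable_clock i.1 i.2
    simp only [hD.law_clock] at h
    have h2 := Measure.infinitePi_map_curry
      (fun (c : Clock) (_ : ℕ) => expLaw (c.rate lam mu1 mu2 mu12))
    rw [← h, Measure.map_map (MeasurableEquiv.curry Clock ℕ ℝ≥0∞).measurable hmc,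
      Measure.infinitePi_eq_pi] at h2
    exact h2
  have hco : P.map (fun ω n => D.coin n ω) = iid (P.map (D.coin 0)) := by
    have h := hD.indep_coin.map_fun_eq_infinitePi_map hD.measurable_coin
    simp only [hD.map_coin] at h
    exact h
  have hind : IndepFun (fun ω c n => D.clock c n ω) (fun ω n => D.coin n ω) P :=
    hD.indep_clock_coin.comp (φ := MeasurableEquiv.curry Clock ℕ ℝ≥0∞) (by fun_prop) measurable_id
  rw [inputsLaw, ← hcl, ← hco]
  exact (indepFun_iff_map_prod_eq_prod_map_map (measurable_pi_lambda _ fun c =>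
    measurable_pi_lambda _ fun n => hD.measurable_clock c n).aemeasurable hmb.aemeasurable).1 hind

theorem Input.IsMMD2.map_init_inputs (hD : D.IsMMD2 P lam mu1 mu2 mu12 p) :
    P.map (fun ω => (D.init ω, D.inputs ω)) = (P.map D.init).prod (P.map D.inputs) := by
  refine (indepFun_iff_map_prod_eq_prod_map_map hD.measurable_init.aemeasurable
    hD.measurable_inputs.aemeasurable).1 ?_
  exact hD.indep_init.comp (ψ := Prod.map (MeasurableEquiv.curry Clock ℕ ℝ≥0∞) id) measurable_id
    (by fun_prop)

/-- Conditioning on the initial state. -/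
theorem Input.IsMMD2.measure_config_mem (hD : D.IsMMD2 P lam mu1 mu2 mu12 p)
    [IsProbabilityMeasure (P.map (D.coin 0))] {B : Set Config} (hB : MeasurableSet B) :
    P {ω | D.config ω ∈ B} = ∫⁻ j, inputsLaw (Clock.rate lam mu1 mu2 mu12) (P.map (D.coin 0))
      {x | configOf j x ∈ B} ∂P.map D.init := by
  have hB' := hB.preimage measurable_configOf_uncurry
  have h : P {ω | D.config ω ∈ B} = P.map (fun ω => (D.init ω, D.inputs ω))
      ((fun q : State × Inputs => configOf q.1 q.2) ⁻¹' B) := by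
    rw [Measure.map_apply (hD.measurable_init.prodMk hD.measurable_inputs) hB']
    rfl
  have : IsProbabilityMeasure (P.map D.inputs) :=
    Measure.isProbabilityMeasure_map hD.measurable_inputs.aemeasurable
  rw [h, hD.map_init_inputs, Measure.prod_apply hB', hD.map_inputs]
  rfl

end Queue

end MMD2

theorem theorem1 {Ω : Type*} [MeasurableSpace Ω] (P : Measure Ω) [IsProbabilityMeasure P]
    (lam mu1 mu2 mu12 p : ℝ) (hlam : 0 < lam) (hmu1 : 0 ≤ mu1) (hmu2 : 0 ≤ mu2)
    (hmu12 : 0 ≤ mu12) (hp0 : 0 ≤ p) (hp1 : p ≤ 1)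
    (D : MMD2.Input Ω) (hD : D.IsMMD2 P lam mu1 mu2 mu12 p) :
    MMD2.IsCTMC P D.process (MMD2.rateMatrix lam mu1 mu2 mu12 p) := by
  have hρ : ∀ c, 0 ≤ MMD2.Clock.rate lam mu1 mu2 mu12 c := by
    intro c; cases c
    exacts [hlam.le, hmu1, hmu2, hmu12]
  have harr : 0 < MMD2.Clock.rate lam mu1 mu2 mu12 .arrival := hlam
  have hprob : IsProbabilityMeasure (P.map (D.coin 0)) :=
    Measure.isProbabilityMeasure_map (hD.measurable_coin 0).aemeasurable
  have hβ : (P.map (D.coin 0)).real {true} = p := by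
    rw [map_measureReal_apply (hD.measurable_coin 0) (measurableSet_singleton true),
      ← ENNReal.toReal_ofReal hp0]
    exact congrArg ENNReal.toReal (hD.law_coin 0)
  refine ⟨fun t => (MMD2.measurable_stateAt_right t).comp hD.measurable_config, ?_,
    MMD2.transition (MMD2.Clock.rate lam mu1 mu2 mu12) (P.map (D.coin 0)),
    MMD2.isTransitionFunction_transition hρ harr, ?_, ?_⟩
  -- The states are countable, so one null set serves for all of them and the conclusion applies to
  -- the random initial state.
  · have h : ∀ᵐ ω ∂P, ∀ j, (MMD2.configOf j (D.inputs ω)).Regular := by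
      refine ae_all_iff.2 fun j => ae_of_ae_map
        (p := fun x => (MMD2.configOf j x).Regular) hD.measurable_inputs.aemeasurable ?_
      rw [hD.map_inputs]
      exact MMD2.ae_regular hρ harr j
    filter_upwards [h] with ω hω t
    exact (hω (D.init ω)).eventually_stateAt_eq t
  · have : MMD2.rateMatrix lam mu1 mu2 mu12 p = fun i j => _ :=
      funext fun i => funext fun j => MMD2.rateMatrix_eq hlam.le hmu1 hmu2 hmu12 hβ i j
    rw [this]
    exact MMD2.hasRateMatrix_transition hρ harr
  · intro n t i ht
    rw [← MMD2.inputsLaw_real_path hρ harr n ht i]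
    have hB1 : MeasurableSet {c : MMD2.Config | c.stateAt (t 0) = i 0} :=
      MMD2.measurable_stateAt_right _ (measurableSet_singleton _)
    have hB2 : MeasurableSet {c : MMD2.Config | ∀ k < n, c.stateAt (t (k + 1)) = i (k + 1)} := by
      have : {c : MMD2.Config | ∀ k < n, c.stateAt (t (k + 1)) = i (k + 1)} =
          ⋂ k ∈ Finset.range n, (fun c => c.stateAt (t (k + 1))) ⁻¹' {i (k + 1)} := by ext; simp
      rw [this]
      exact Finset.measurableSet_biInter _ fun k _ =>
        MMD2.measurable_stateAt_right _ (measurableSet_singleton _)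
    have h1 : {ω | ∀ k ≤ n, D.process (t k) ω = i k} = {ω | D.config ω ∈
        {c : MMD2.Config | c.stateAt (t 0) = i 0} ∩
          {c | ∀ k < n, c.stateAt (t (k + 1)) = i (k + 1)}} := by
      ext ω
      have := Nat.forall_lt_succ_left (n := n) (p := fun k => D.process (t k) ω = i k)
      simp only [Nat.lt_succ_iff] at this
      exact this
    have h2 := hD.measure_config_mem hB1
    have h3 := hD.measure_config_mem (hB1.inter hB2)
    rw [measureReal_def, measureReal_def, measureReal_def, ← ENNReal.toReal_mul, h1, h3]
    congr 1
    refine Eq.trans ?_ (congrArg (· * _) h2.symm)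
    -- The factor for the path after `t 0` depends on `i 0` but not on the initial state `j`, so it
    -- can be moved inside the average over `j` and compared pointwise.
    rw [← lintegral_mul_const' _ _ (measure_ne_top _ _)]
    refine lintegral_congr fun j => ?_
    refine Eq.trans ?_ (MMD2.inputsLaw_markov hρ harr j (i 0) (t 0) n
      (fun k => t (k + 1) - t 0) fun k => i (k + 1))
    congr 1
    ext x
    refine and_congr Iff.rfl (forall₂_congr fun k _ => ?_)
    rw [add_tsub_cancel_of_le (ht (Nat.zero_le _))]
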